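/- Let $m\ge 2$, let $V=\mathbb{C}^{2m+1}$ with standard basis $v_1,\dots,v_{2m+1}$, put $\bar v_i=v_{2m+2-i}$, and let $\Phi$ be the symmetric bilinear form with $2\Phi(v_i,v_{2m+2-j})=(-1)^{m+1-i}\delta_{ij}$. Let $\mathrm{Cl}(V)$ be the Clifford algebra with $xy+yx=2\Phi(x,y)$ for $x,y\in V$, and let $\mathrm{Spin}(V)\subset \mathrm{Cl}(V)$ be the spin group, acting on $V$ by $g\cdot x=gxg^{-1}$. Put $f_i=(-1)^{m+1-i}v_{i+1}\bar v_i$ for $1\le i<m$, $f_m=\sqrt2\,\bar v_m v_{m+1}$, and $y_i(a)=\exp(af_i)\in\mathrm{Spin}(V)$. Let $W=\langle v_1,\dots,v_m\rangle$ and let $V_{\mathrm{Spin}}=\bigwedge^\bullet W$ be the spin representation of $\mathrm{Cl}(V)$: for $i\le m$, $v_i$ acts by left multiplication $v_i\wedge\cdot$, $\bar v_i$ by contraction with the linear form $2\Phi(\bar v_i,\cdot)$ on $W$, and $v_{m+1}$ by $(-1)^k/\sqrt2$ on $\bigwedge^kW$. For a strict partition $\lambda=(\lambda_1>\dots>\lambda_k)$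 with $\lambda_1\le m$ let $w_\lambda=v_{m+1-\lambda_1}\wedge\dots\wedge v_{m+1-\lambda_k}$, and for $g\in \mathrm{Spin}(V)$ let $p_\lambda(g)=w_\emptyset^*(g\cdot w_\lambda)$, where $w_\emptyset^*:V_{\mathrm{Spin}}\to\mathbb{C}$ is the projection to $\bigwedge^0W$; if $\lambda$ is not strict, put $p_\lambda=0$. For $g\in\mathrm{Spin}(V)$ let $\Delta^{I}_{J}(g)$ be the minor with rows $I$ and columns $J$ of the matrix of $g$ acting on $V$ in the basis $(v_i)$. For $1\le l\le m-1$ let $\rho_l=(l,l-1,\dots,1)$, $\rho_{l,+}=(l+1,l-1,\dots,1)$ and $\mu_l=(m,m-1,\dots,m+1-l)$. For $I\subset\{1,\dots,l\}$ let $\rho_l^I$ (respectively $\rho_{l,+}^I$) be obtained from $\rho_l$ (respectively $\rho_{l,+}$) by removing the $i$-th line for each $i\in I$, and let $\mu_l^I$ (respectively $\mu_{l,+}^I$) be obtained from $\mu_l$ by adding these removed lines at the bottom. Let $s_l(I)=\sum_{i\in I}(l+1-i)$, the sum of the lengths of the lines of $\rho_l$ indexed by $I$. Let $$\bar u_2=\big(y_m(a_{m,m})y_{m-1}(a_{m-1,m})\cdots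 y_1(a_{1,m})\big)\cdots\big(y_m(a_{m,2})y_{m-1}(a_{m-1,2})\big)\,y_m(a_{m,1})$$ with all $a_{i,c}\in\mathbb{C}$ nonzero ($1\le c\le m$, $m+1-c\le i\le m$); this is the factorized form of a generic element of $U_-\cap B_+(\dot w^P)^{-1}B_+$, where $P$ is the parabolic subgroup of $\mathrm{Spin}(V)$ attached to the $m$-th node. Then for every $j=2,\dots,m$, with $l=m+1-j$, $$\sum_{I\subset\{1,\dots,l\}}(-1)^{s_l(I)}\,p_{\rho_l^I}(\bar u_2)\,p_{\mu_l^I}(\bar u_2)=\Delta^{m+1,\dots,2m+1}_{j,\,j+1,\dots,\,j+m}(\bar u_2)$$ and $$\sum_{I\subset\{1,\dots,l\}}(-1)^{s_l(I)}\,p_{\rho_{l,+}^I}(\bar u_2)\,p_{\mu_{l,+}^I}(\bar u_2)=\Delta^{m+1,\dots,2m+1}_{j-1,\,j+1,\dots,\,j+m}(\bar u_2).$$ -/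

import Mathlib

namespace LagrangianMirror

open CliffordAlgebra

noncomputable section

/-- The space `V = ℂ^(2m+1)`. The zero-based position `k` is the coordinate along `v_{k+1}`. -/
abbrev V (m : ℕ) : Type := Fin (2 * m + 1) → ℂ

/-- The space `W = ⟨v_1, …, v_m⟩`. -/
abbrev W (m : ℕ) : Type := Fin m → ℂ

/-- The basis vector `v_i` of `V`, for `1 ≤ i ≤ 2m+1` (and `0` for other `i`).
The vector `v̄_i` is `v_{2m+2-i}`. -/
def v (m i : ℕ) : V m := fun k => if k.val + 1 = i then 1 else 0

/-- The basis vector `v_i` of `W`, for `1 ≤ i ≤ m` (and `0` for other `i`). -/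
def vW (m i : ℕ) : W m := fun k => if k.val + 1 = i then 1 else 0

/-- The inclusion of `W` in `V`. -/
def incl (m : ℕ) : W m →ₗ[ℂ] V m where
  toFun w := fun k => if h : k.val < m then w ⟨k.val, h⟩ else 0
  map_add' x y := by ext k; by_cases h : k.val < m <;> simp [h]
  map_smul' c x := by ext k; by_cases h : k.val < m <;> simp [h]

/-- The coordinates along `v_1, …, v_m`. -/
def projW (m : ℕ) : V m →ₗ[ℂ] W m where
  toFun x := fun i => x ⟨i.val, by omega⟩
  map_add' _ _ := rfl
  map_smul' _ _ := rfl

/-- The coordinate along `v_{m+1}`. -/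
def mid (m : ℕ) : V m →ₗ[ℂ] ℂ := LinearMap.proj ⟨m, by omega⟩

/-- The symmetric bilinear form with `2 Φ(v_i, v_{2m+2-j}) = (-1)^(m+1-i) δ_{ij}`. -/
def Phi (m : ℕ) : LinearMap.BilinForm ℂ (V m) :=
  LinearMap.mk₂ ℂ (fun x y => ∑ k : Fin (2 * m + 1), (-1) ^ (m + k.val) / 2 * (x k * y k.rev))
    (by intros; simp [add_mul, mul_add, Finset.sum_add_distrib])
    (by
      intro c x y
      rw [smul_eq_mul, Finset.mul_sum]
      exact Finset.sum_congr rfl fun k _ => by simp only [Pi.smul_apply, smul_eq_mul]; ring)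
    (by intros; simp [mul_add, Finset.sum_add_distrib])
    (by
      intro c x y
      rw [smul_eq_mul, Finset.mul_sum]
      exact Finset.sum_congr rfl fun k _ => by simp only [Pi.smul_apply, smul_eq_mul]; ring)

theorem Phi_apply (m : ℕ) (x y : V m) :
    Phi m x y = ∑ k : Fin (2 * m + 1), (-1) ^ (m + k.val) / 2 * (x k * y k.rev) := rfl

/-- The quadratic form `x ↦ Φ(x, x)`. In its Clifford algebra `x y + y x = 2 Φ(x, y)`. -/
def Q (m : ℕ) : QuadraticForm ℂ (V m) := (Phi m).toQuadraticMap

theorem Q_apply (m : ℕ) (x : V m) : Q m x = Phi m x x := rfl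

theorem neg_one_pow_rev {m : ℕ} (k : Fin (2 * m + 1)) :
    (-1 : ℂ) ^ (m + k.rev.val) = (-1) ^ (m + k.val) := by
  have h1 : (k.rev.val : ℕ) + k.val = 2 * m := by rw [Fin.val_rev]; omega
  have h2 : (-1 : ℂ) ^ (m + k.rev.val) * (-1) ^ (m + k.val) = 1 := by
    rw [← pow_add]; exact Even.neg_one_pow ⟨2 * m, by omega⟩
  have h3 : (-1 : ℂ) ^ (m + k.val) * (-1) ^ (m + k.val) = 1 := by
    rw [← pow_add]; exact Even.neg_one_pow ⟨m + k.val, by omega⟩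
  have h4 : (-1 : ℂ) ^ (m + k.val) ≠ 0 := pow_ne_zero _ (by norm_num)
  exact mul_right_cancel₀ h4 (h2.trans h3.symm)

theorem Phi_symm (m : ℕ) (x y : V m) : Phi m x y = Phi m y x := by
  rw [Phi_apply, Phi_apply]
  refine Fintype.sum_equiv Fin.revPerm _ _ fun k => ?_
  simp only [Fin.revPerm_apply, Fin.rev_rev, neg_one_pow_rev]
  ring

theorem Phi_v_left (m i : ℕ) (hi : 1 ≤ i) (hi' : i ≤ 2 * m + 1) (y : V m) :
    Phi m (v m i) y = (-1) ^ (m + (i - 1)) / 2 * y ⟨2 * m + 1 - i, by omega⟩ := by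
  rw [Phi_apply, Finset.sum_eq_single (⟨i - 1, by omega⟩ : Fin (2 * m + 1))]
  · have h : (⟨i - 1, by omega⟩ : Fin (2 * m + 1)).rev = ⟨2 * m + 1 - i, by omega⟩ := by
      ext; rw [Fin.val_rev]; simp; omega
    rw [h]
    simp [v, Nat.sub_add_cancel hi]
  · intro k _ hk
    have : k.val + 1 ≠ i := fun h => hk (by ext; simp; omega)
    simp [v, this]
  · simp

theorem v_zero (m : ℕ) : v m 0 = 0 := by ext k; simp [v]

theorem v_big (m i : ℕ) (hi : 2 * m + 1 < i) : v m i = 0 := by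
  ext k
  have : k.val + 1 ≠ i := by omega
  simp [v, this]

theorem Phi_v_v_eq_zero (m i j : ℕ) (h : i + j ≠ 2 * m + 2) : Phi m (v m i) (v m j) = 0 := by
  by_cases hi : 1 ≤ i
  · by_cases hi' : i ≤ 2 * m + 1
    · rw [Phi_v_left m i hi hi']
      have : 2 * m + 1 - i + 1 ≠ j := by omega
      simp [v, this]
    · rw [v_big m i (by omega)]; simp
  · have : i = 0 := by omega
    subst this; rw [v_zero]; simp

theorem Q_v_mid (m : ℕ) : Q m (v m (m + 1)) = 1 / 2 := by
  rw [Q_apply, Phi_v_left m (m + 1) (by omega) (by omega)]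
  have h : 2 * m - m = m := by omega
  have h2 : (-1 : ℂ) ^ (m + (m + 1 - 1)) = 1 := Even.neg_one_pow ⟨m, by omega⟩
  rw [h2]; simp [v, h]

/-- The Clifford algebra of `V`. -/
abbrev Cl (m : ℕ) : Type := CliffordAlgebra (Q m)

theorem anticomm (m : ℕ) (x y : V m) :
    ι (Q m) x * ι (Q m) y + ι (Q m) y * ι (Q m) x = algebraMap ℂ (Cl m) (2 * Phi m x y) := by
  rw [CliffordAlgebra.ι_mul_ι_add_swap]
  congr 1
  rw [QuadraticMap.polar, Q_apply, Q_apply, Q_apply]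
  simp only [map_add, LinearMap.add_apply]
  rw [Phi_symm m y x]; ring

/-- The group `G = Spin(V)`, inside the Clifford algebra. -/
abbrev Spin (m : ℕ) : Type := spinGroup (Q m)

/-- The Chevalley generators `f_1, …, f_m` of `so(V)` in the Clifford algebra:
`f_i = (-1)^(m+1-i) v_{i+1} v̄_i` for `i < m`, and `f_m = √2 v̄_m v_{m+1}`. -/
def f (m i : ℕ) : Cl m :=
  if i < m then (-1 : ℂ) ^ (m + 1 - i) • (ι (Q m) (v m (i + 1)) * ι (Q m) (v m (2 * m + 2 - i)))
  else ((Real.sqrt 2 : ℝ) : ℂ) • (ι (Q m) (v m (m + 2)) * ι (Q m) (v m (m + 1)))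

theorem swap_of_orth {m : ℕ} {x y : V m} (h : Phi m x y = 0) :
    ι (Q m) y * ι (Q m) x = -(ι (Q m) x * ι (Q m) y) := by
  have := anticomm m x y
  rw [h, mul_zero, map_zero] at this
  exact (neg_eq_of_add_eq_zero_right this).symm

theorem sq_of_iso {m : ℕ} {x : V m} (h : Phi m x x = 0) : ι (Q m) x * ι (Q m) x = 0 := by
  rw [ι_sq_scalar, Q_apply, h, map_zero]

theorem mul_sq_zero {m : ℕ} {x y : V m} (hx : Phi m x x = 0) (hxy : Phi m x y = 0) :
    (ι (Q m) x * ι (Q m) y) ^ 2 = 0 := by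
  have h1 := swap_of_orth hxy
  have h2 := sq_of_iso hx
  calc (ι (Q m) x * ι (Q m) y) ^ 2
      = ι (Q m) x * (ι (Q m) y * ι (Q m) x) * ι (Q m) y := by noncomm_ring
    _ = -((ι (Q m) x * ι (Q m) x) * ι (Q m) y * ι (Q m) y) := by rw [h1]; noncomm_ring
    _ = 0 := by rw [h2]; simp

theorem f_sq (m i : ℕ) : f m i ^ 2 = 0 := by
  unfold f
  split_ifs with h
  · rw [smul_pow, mul_sq_zero (Phi_v_v_eq_zero _ _ _ (by omega)) (Phi_v_v_eq_zero _ _ _ (by omega)),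
      smul_zero]
  · rw [smul_pow, mul_sq_zero (Phi_v_v_eq_zero _ _ _ (by omega)) (Phi_v_v_eq_zero _ _ _ (by omega)),
      smul_zero]

theorem exp_f (m i : ℕ) (a : ℂ) : IsNilpotent.exp (a • f m i) = 1 + a • f m i := by
  rw [IsNilpotent.exp_eq_sum (k := 2) (by rw [smul_pow, f_sq, smul_zero])]
  simp [Finset.sum_range_succ]

theorem mul_mem_spin {m : ℕ} (x y : V m) (h : Q m x * Q m y = 1) :
    ι (Q m) x * ι (Q m) y ∈ spinGroup (Q m) := by
  have hx : Q m x ≠ 0 := left_ne_zero_of_mul_eq_one h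
  have hy : Q m y ≠ 0 := right_ne_zero_of_mul_eq_one h
  have key : ∀ z : V m, Q m z ≠ 0 →
      ι (Q m) z ∈ (lipschitzGroup (Q m)).toSubmonoid.map (Units.coeHom (Cl m)) := by
    intro z hz
    have hu : ι (Q m) z * ((Q m z)⁻¹ • ι (Q m) z) = 1 := by
      rw [mul_smul_comm, ι_sq_scalar, Algebra.algebraMap_eq_smul_one, smul_smul,
        inv_mul_cancel₀ hz, one_smul]
    have hu' : ((Q m z)⁻¹ • ι (Q m) z) * ι (Q m) z = 1 := by
      rw [smul_mul_assoc, ι_sq_scalar, Algebra.algebraMap_eq_smul_one, smul_smul,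
        inv_mul_cancel₀ hz, one_smul]
    exact ⟨⟨ι (Q m) z, _, hu, hu'⟩, Subgroup.subset_closure ⟨z, rfl⟩, rfl⟩
  have hst : star (ι (Q m) x * ι (Q m) y) = ι (Q m) y * ι (Q m) x := by
    rw [star_mul, star_ι, star_ι, neg_mul_neg]
  have mid4 : ∀ p q : V m, ι (Q m) p * ι (Q m) q * (ι (Q m) q * ι (Q m) p)
      = algebraMap ℂ (Cl m) (Q m p * Q m q) := by
    intro p q
    calc ι (Q m) p * ι (Q m) q * (ι (Q m) q * ι (Q m) p)
        = ι (Q m) p * (ι (Q m) q * ι (Q m) q) * ι (Q m) p := by noncomm_ring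
      _ = algebraMap ℂ (Cl m) (Q m q) * (ι (Q m) p * ι (Q m) p) := by
          rw [ι_sq_scalar, ← Algebra.commutes, mul_assoc]
      _ = _ := by rw [ι_sq_scalar, ← map_mul, mul_comm (Q m q)]
  refine ⟨⟨mul_mem (key x hx) (key y hy), ?_, ?_⟩, ?_⟩
  · rw [hst, mid4, mul_comm (Q m y), h, map_one]
  · rw [hst, mid4, h, map_one]
  · exact ι_mul_ι_mem_evenOdd_zero (Q m) x y

theorem one_add_mem_spin {m : ℕ} {x z : V m} (hx : Phi m x x = 0) (hxz : Phi m x z = 0)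
    (hz : Phi m z z = 1 / 2) : 1 + ι (Q m) x * ι (Q m) z ∈ spinGroup (Q m) := by
  have h := mul_mem_spin ((2 : ℂ) • z + x) z (by
    rw [Q_apply, Q_apply]
    simp only [map_add, LinearMap.add_apply, map_smul, LinearMap.smul_apply, Phi_symm m z x,
      hx, hxz, hz, smul_eq_mul]
    norm_num)
  have e : ι (Q m) ((2 : ℂ) • z + x) * ι (Q m) z = 1 + ι (Q m) x * ι (Q m) z := by
    rw [map_add, map_smul, add_mul, smul_mul_assoc, ι_sq_scalar, Q_apply, hz,
      Algebra.algebraMap_eq_smul_one, smul_smul]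
    norm_num
  rwa [e] at h

theorem y_mem_spin (m i : ℕ) (a : ℂ) : IsNilpotent.exp (a • f m i) ∈ spinGroup (Q m) := by
  have hz : Phi m (v m (m + 1)) (v m (m + 1)) = 1 / 2 := Q_v_mid m
  rw [exp_f]
  unfold f
  split_ifs with h
  · rw [smul_smul]
    set s : ℂ := a * (-1) ^ (m + 1 - i)
    have huu : Phi m (v m (i + 1)) (v m (i + 1)) = 0 := Phi_v_v_eq_zero _ _ _ (by omega)
    have hww : Phi m (v m (2 * m + 2 - i)) (v m (2 * m + 2 - i)) = 0 :=
      Phi_v_v_eq_zero _ _ _ (by omega)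
    have huw : Phi m (v m (i + 1)) (v m (2 * m + 2 - i)) = 0 := Phi_v_v_eq_zero _ _ _ (by omega)
    have huz : Phi m (v m (i + 1)) (v m (m + 1)) = 0 := Phi_v_v_eq_zero _ _ _ (by omega)
    have hwz : Phi m (v m (2 * m + 2 - i)) (v m (m + 1)) = 0 := Phi_v_v_eq_zero _ _ _ (by omega)
    generalize v m (i + 1) = u at *
    generalize v m (2 * m + 2 - i) = w at *
    generalize v m (m + 1) = z at *
    -- a commutator of one-parameter elements of the first kind
    have h1 : 1 + ι (Q m) ((-2 * s) • u) * ι (Q m) z ∈ spinGroup (Q m) :=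
      one_add_mem_spin (by simp [huu]) (by simp [huz]) hz
    have h2 : 1 + ι (Q m) w * ι (Q m) z ∈ spinGroup (Q m) := one_add_mem_spin hww hwz hz
    have h3 : 1 + ι (Q m) (-((-2 * s) • u + w)) * ι (Q m) z ∈ spinGroup (Q m) :=
      one_add_mem_spin (by simp [huu, huw, hww, Phi_symm m w u]) (by simp [huz, hwz]) hz
    have h123 := mul_mem (mul_mem h1 h2) h3
    have e : (1 + ι (Q m) ((-2 * s) • u) * ι (Q m) z) * (1 + ι (Q m) w * ι (Q m) z)
        * (1 + ι (Q m) (-((-2 * s) • u + w)) * ι (Q m) z)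
        = 1 + s • (ι (Q m) u * ι (Q m) w) := by
      have hzu := swap_of_orth huz
      have hzw := swap_of_orth hwz
      have hwu := swap_of_orth huw
      have uu := sq_of_iso huu
      have ww := sq_of_iso hww
      have zz : ι (Q m) z * ι (Q m) z = (1 / 2 : ℂ) • 1 := by
        rw [ι_sq_scalar, Q_apply, hz, Algebra.algebraMap_eq_smul_one]
      simp only [map_neg, map_add, map_smul]
      generalize ι (Q m) u = U at *
      generalize ι (Q m) w = X at *
      generalize ι (Q m) z = Z at *
      have a1 : U * Z * (X * Z) = (-1 / 2 : ℂ) • (U * X) := by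
        calc U * Z * (X * Z) = U * (Z * X) * Z := by noncomm_ring
          _ = -(U * X * (Z * Z)) := by rw [hzw]; noncomm_ring
          _ = _ := by rw [zz, mul_smul_comm, mul_one, ← neg_smul]; norm_num
      have a2 : X * Z * (U * Z) = (1 / 2 : ℂ) • (U * X) := by
        calc X * Z * (U * Z) = X * (Z * U) * Z := by noncomm_ring
          _ = -(X * U * (Z * Z)) := by rw [hzu]; noncomm_ring
          _ = _ := by rw [zz, hwu, mul_smul_comm, mul_one, smul_neg, neg_neg]
      have a3 : U * Z * (U * Z) = 0 := by
        calc U * Z * (U * Z) = U * (Z * U) * Z := by noncomm_ring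
          _ = -(U * U * (Z * Z)) := by rw [hzu]; noncomm_ring
          _ = _ := by rw [uu]; simp
      have a4 : X * Z * (X * Z) = 0 := by
        calc X * Z * (X * Z) = X * (Z * X) * Z := by noncomm_ring
          _ = -(X * X * (Z * Z)) := by rw [hzw]; noncomm_ring
          _ = _ := by rw [ww]; simp
      have a5 : U * X * (U * Z) = 0 := by
        calc U * X * (U * Z) = U * (X * U) * Z := by noncomm_ring
          _ = -(U * U * (X * Z)) := by rw [hwu]; noncomm_ring
          _ = _ := by rw [uu]; simp
      have a6 : U * X * (X * Z) = 0 := by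
        calc U * X * (X * Z) = U * (X * X) * Z := by noncomm_ring
          _ = _ := by rw [ww]; simp
      have b1 : (1 + (-2 * s) • U * Z) * (1 + X * Z)
          = 1 + (-2 * s) • (U * Z) + X * Z + s • (U * X) := by
        simp only [add_mul, mul_add, one_mul, mul_one, smul_mul_assoc, a1, smul_smul]
        rw [show -2 * s * (-1 / 2) = s by ring]
        abel
      rw [b1]
      simp only [add_mul, mul_add, one_mul, mul_one, smul_mul_assoc, mul_smul_comm, neg_mul,
        mul_neg, a1, a2, a3, a4, a5, a6, smul_smul, smul_zero, smul_add, neg_add,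
        add_zero]
      module
    rwa [e] at h123
  · rw [smul_smul, ← smul_mul_assoc, ← map_smul]
    refine one_add_mem_spin ?_ ?_ hz
    · simp [Phi_v_v_eq_zero m (m + 2) (m + 2) (by omega)]
    · simp [Phi_v_v_eq_zero m (m + 2) (m + 1) (by omega)]

/-- The one-parameter subgroup `y_i(a) = exp(a f_i)` of `Spin(V)`, for `1 ≤ i ≤ m`.
As `f_i` squares to zero in the Clifford algebra, the exponential is a finite sum. -/
def y (m i : ℕ) (a : ℂ) : Spin m := ⟨IsNilpotent.exp (a • f m i), y_mem_spin m i a⟩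

/-- The factorized element
`(y_m(a_{m,m}) y_{m-1}(a_{m-1,m}) ⋯ y_1(a_{1,m})) ⋯ (y_m(a_{m,2}) y_{m-1}(a_{m-1,2})) y_m(a_{m,1})`:
the blocks are numbered `c = m, …, 1` from left to right, and block `c` is
`y_m(a_{m,c}) y_{m-1}(a_{m-1,c}) ⋯ y_{m+1-c}(a_{m+1-c,c})`. -/
def ubar (m : ℕ) (a : ℕ → ℕ → ℂ) : Spin m :=
  ((List.range m).map fun k =>
    ((List.range (m - k)).map fun t => y m (m - t) (a (m - t) (m - k))).prod).prod

/-! ### The action of `Spin(V)` on `V` and the minors -/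

theorem ι_injective (m : ℕ) : Function.Injective (ι (Q m)) := by
  have : Invertible (2 : ℂ) := invertibleOfNonzero two_ne_zero
  intro x x' h
  have := congrArg (equivExterior (Q m)) h
  rw [equivExterior, changeFormEquiv_apply, changeFormEquiv_apply, changeForm_ι, changeForm_ι]
    at this
  exact ExteriorAlgebra.ι_leftInverse.injective this

theorem conj_mem {m : ℕ} (g : Spin m) (x : V m) :
    (g : Cl m) * ι (Q m) x * (g⁻¹ : Spin m) ∈ LinearMap.range (ι (Q m)) := by
  have : Invertible (2 : ℂ) := invertibleOfNonzero two_ne_zero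
  exact spinGroup.conjAct_smul_ι_mem_range_ι (x := spinGroup.toUnits g) g.2 x

/-- The action of `g ∈ Spin(V)` on `V`: the vector `g · x` is `g x g⁻¹` in the Clifford algebra. -/
def act {m : ℕ} (g : Spin m) (x : V m) : V m :=
  (LinearEquiv.ofInjective (ι (Q m)) (ι_injective m)).symm
    ⟨(g : Cl m) * ι (Q m) x * (g⁻¹ : Spin m), conj_mem g x⟩

theorem ι_act {m : ℕ} (g : Spin m) (x : V m) :
    ι (Q m) (act g x) = (g : Cl m) * ι (Q m) x * (g⁻¹ : Spin m) :=
  congrArg Subtype.val ((LinearEquiv.ofInjective (ι (Q m)) (ι_injective m)).apply_symm_apply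
    ⟨(g : Cl m) * ι (Q m) x * (g⁻¹ : Spin m), conj_mem g x⟩)

/-- The coordinate `v_i^*` along `v_i`, for `1 ≤ i ≤ 2m+1` (and `0` for other `i`). -/
def coord (m i : ℕ) (x : V m) : ℂ :=
  if h : 1 ≤ i ∧ i ≤ 2 * m + 1 then x ⟨i - 1, by omega⟩ else 0

/-- The minor of `g`, acting on `V`, with rows `I 0 < ⋯ < I (r-1)` and columns
`J 0 < ⋯ < J (r-1)`. -/
def minor {m r : ℕ} (g : Spin m) (I J : Fin r → ℕ) : ℂ :=
  (Matrix.of fun s t => coord m (I s) (act g (v m (J t)))).det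

/-! ### The spin representation and the generalized Plücker coordinates -/

/-- The spin representation, as a vector space. -/
abbrev VSpin (m : ℕ) : Type := ExteriorAlgebra ℂ (W m)

/-- The action of a vector `x ∈ V` on the spin representation: `v_1, …, v_m` act by left
multiplication, `v_{m+1}` by `(-1)^k / √2` in degree `k`, and `v̄_1, …, v̄_m` by contraction with
the linear form `2 Φ(v̄_i, ·)` on `W`. The form `2 Φ(x, ·)` on `W` sees only the components of `x`
along the `v̄_i`. -/
def cliffordAction (m : ℕ) : V m →ₗ[ℂ] Module.End ℂ (VSpin m) :=
  (LinearMap.mul ℂ (VSpin m)) ∘ₗ ExteriorAlgebra.ι ℂ ∘ₗ projW m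
  + (mid m).smulRight
      ((((Real.sqrt 2 : ℝ) : ℂ)⁻¹) • (CliffordAlgebra.involute (Q := 0)).toLinearMap)
  + CliffordAlgebra.contractLeft (Q := 0) ∘ₗ (LinearMap.lcomp ℂ ℂ (incl m)) ∘ₗ
      ((2 : ℂ) • Phi m)

theorem cliffordAction_apply (m : ℕ) (x : V m) (ω : VSpin m) :
    cliffordAction m x ω = ExteriorAlgebra.ι ℂ (projW m x) * ω
      + (mid m x * ((Real.sqrt 2 : ℝ) : ℂ)⁻¹) • CliffordAlgebra.involute (Q := 0) ω
      + CliffordAlgebra.contractLeft (Q := 0) (((2 : ℂ) • Phi m x) ∘ₗ incl m) ω := by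
  simp only [cliffordAction, LinearMap.add_apply, LinearMap.comp_apply, LinearMap.smulRight_apply,
    LinearMap.smul_apply, smul_smul]
  rfl

theorem involute_contractLeft {m : ℕ} (d : Module.Dual ℂ (W m)) (ω : VSpin m) :
    CliffordAlgebra.involute (Q := 0) (CliffordAlgebra.contractLeft (Q := 0) d ω)
      = -CliffordAlgebra.contractLeft (Q := 0) d (CliffordAlgebra.involute (Q := 0) ω) := by
  induction ω using CliffordAlgebra.left_induction with
  | algebraMap r => simp
  | add _ _ hx hy => rw [map_add, map_add, hx, hy, map_add, map_add, neg_add]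
  | ι_mul x w hx =>
    rw [contractLeft_ι_mul, map_sub, map_smul, map_mul, map_mul, involute_ι, hx,
      neg_mul (ι 0 w) (involute x), map_neg (CliffordAlgebra.contractLeft d), contractLeft_ι_mul]
    noncomm_ring

theorem two_Phi_incl_projW (m : ℕ) (x : V m) :
    2 * Phi m x (incl m (projW m x)) + mid m x * mid m x / 2 = Q m x := by
  let g : Fin (2 * m + 1) → ℂ := fun k => (-1) ^ (m + k.val) / 2 * (x k * x k.rev)
  have hg : ∀ k, g k.rev = g k := fun k => by
    simp only [g, Fin.rev_rev, neg_one_pow_rev]; ring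
  have h1 : Phi m x (incl m (projW m x)) = ∑ k, if m < k.val then g k else 0 := by
    rw [Phi_apply]
    refine Finset.sum_congr rfl fun k _ => ?_
    have hk := Fin.val_rev k
    by_cases h : m < k.val
    · have h' : k.rev.val < m := by omega
      simp only [incl, projW, LinearMap.coe_mk, AddHom.coe_mk, dif_pos h', if_pos h, g]
    · have h' : ¬ k.rev.val < m := by omega
      simp only [incl, LinearMap.coe_mk, AddHom.coe_mk, dif_neg h', if_neg h, mul_zero]
  have h2 : (∑ k, if m < k.val then g k else 0) = ∑ k, if k.val < m then g k else 0 := by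
    refine Fintype.sum_equiv Fin.revPerm _ _ fun k => ?_
    have hk := Fin.val_rev k
    simp only [Fin.revPerm_apply, hg]
    by_cases h : m < k.val
    · rw [if_pos h, if_pos (by omega)]
    · rw [if_neg h, if_neg (by omega)]
  have h3 : mid m x * mid m x / 2 = ∑ k : Fin (2 * m + 1), if k.val = m then g k else 0 := by
    rw [Finset.sum_eq_single (⟨m, by omega⟩ : Fin (2 * m + 1))]
    · have hr : (⟨m, by omega⟩ : Fin (2 * m + 1)).rev = ⟨m, by omega⟩ := by
        ext; rw [Fin.val_rev]; simp; omega
      have hs : (-1 : ℂ) ^ (m + m) = 1 := Even.neg_one_pow ⟨m, rfl⟩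
      simp only [g, if_true, hr, hs, mid, LinearMap.proj_apply]; ring
    · intro k _ hk
      rw [if_neg fun h => hk (by ext; exact h)]
    · simp
  have h4 : Q m x = ∑ k, g k := rfl
  rw [two_mul, h4]
  nth_rewrite 2 [h1]
  rw [h2, h1, h3, ← Finset.sum_add_distrib, ← Finset.sum_add_distrib]
  refine Finset.sum_congr rfl fun k _ => ?_
  rcases lt_trichotomy k.val m with h | h | h
  · simp [h, h.not_gt, h.ne]
  · simp [h]
  · simp [h, h.not_gt, h.ne']

theorem cliffordAction_sq (m : ℕ) (x : V m) :
    cliffordAction m x * cliffordAction m x = algebraMap ℂ _ (Q m x) := by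
  refine LinearMap.ext fun ω => ?_
  rw [Module.End.mul_apply, Module.algebraMap_end_apply, ← two_Phi_incl_projW m x]
  have hs : (((Real.sqrt 2 : ℝ) : ℂ)⁻¹) * (((Real.sqrt 2 : ℝ) : ℂ)⁻¹) = 1 / 2 := by
    rw [← mul_inv, ← Complex.ofReal_mul, Real.mul_self_sqrt (by norm_num)]; norm_num
  set d : Module.Dual ℂ (W m) := ((2 : ℂ) • Phi m x) ∘ₗ incl m with hd
  have hdw : 2 * Phi m x (incl m (projW m x)) = d (projW m x) := by simp [hd]
  have hc : mid m x * mid m x / 2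
      = (mid m x * ((Real.sqrt 2 : ℝ) : ℂ)⁻¹) * (mid m x * ((Real.sqrt 2 : ℝ) : ℂ)⁻¹) := by
    linear_combination (-(mid m x * mid m x)) * hs
  rw [hdw, hc]
  simp only [cliffordAction_apply]
  rw [← hd]
  generalize mid m x * ((Real.sqrt 2 : ℝ) : ℂ)⁻¹ = c
  generalize projW m x = w
  have e1 : ExteriorAlgebra.ι ℂ w * (ExteriorAlgebra.ι ℂ w * ω) = 0 := by
    rw [← mul_assoc, ExteriorAlgebra.ι_sq_zero, zero_mul]
  have e2 : CliffordAlgebra.contractLeft (Q := 0) d (ExteriorAlgebra.ι ℂ w * ω)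
      = d w • ω - ExteriorAlgebra.ι ℂ w * CliffordAlgebra.contractLeft (Q := 0) d ω :=
    contractLeft_ι_mul (Q := 0) d w ω
  have e3 : CliffordAlgebra.involute (Q := 0) (ExteriorAlgebra.ι ℂ w * ω)
      = -(ExteriorAlgebra.ι ℂ w * CliffordAlgebra.involute (Q := 0) ω) := by
    rw [map_mul, ← neg_mul]; congr 1; exact involute_ι (Q := 0) w
  simp only [map_add, map_smul, mul_add, e1, e2, e3, involute_contractLeft,
    involute_involute, contractLeft_contractLeft, smul_add, smul_smul, mul_smul_comm, smul_neg,
    add_smul]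
  abel

/-- The spin representation of the Clifford algebra, and so of `Spin(V)`. -/
def spinRep (m : ℕ) : Cl m →ₐ[ℂ] Module.End ℂ (VSpin m) :=
  CliffordAlgebra.lift (Q m) ⟨cliffordAction m, cliffordAction_sq m⟩

/-- A diagram is the list of its row lengths. For a strict partition `lam = (λ_1 > ⋯ > λ_k)` in
an `m × m` square, `w m lam` is the basis vector `v_{m+1-λ_1} ∧ ⋯ ∧ v_{m+1-λ_k}` of the spin
representation; it is `0` if the diagram is not a strict partition. -/
def w (m : ℕ) (lam : List ℕ) : VSpin m :=
  if lam.Pairwise (· > ·) then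
    (lam.map fun part => ExteriorAlgebra.ι ℂ (vW m (m + 1 - part))).prod
  else 0

/-- The generalized Plücker coordinate `p_λ(g) = w_∅^*(g · w_λ)`. The functional `w_∅^*` dual to
`w_∅ = 1` is the projection of the exterior algebra to degree zero. -/
def p {m : ℕ} (lam : List ℕ) (g : Spin m) : ℂ :=
  ExteriorAlgebra.algebraMapInv (spinRep m (g : Cl m) (w m lam))

/-! ### The partitions -/

/-- The length of line `i` of the staircase `ρ_l = (l, …, 2, 1)`. -/
def row (l i : ℕ) : ℕ := l + 1 - i

/-- The length of line `i` of `ρ_{l,+} = (l+1, l-1, …, 2, 1)`. -/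
def rowPlus (l i : ℕ) : ℕ := l + 1 - i + if i = 1 then 1 else 0

/-- `ρ_l^I`: the staircase with the lines in `I` removed. -/
def rho (l : ℕ) (I : Finset ℕ) : List ℕ :=
  ((List.range' 1 l).filter (· ∉ I)).map (row l)

/-- `ρ_{l,+}^I`. -/
def rhoPlus (l : ℕ) (I : Finset ℕ) : List ℕ :=
  ((List.range' 1 l).filter (· ∉ I)).map (rowPlus l)

/-- `μ_l^I`: the diagram `μ_l = (m, m-1, …, m+1-l)` with the lines `i ∈ I` of `ρ_l` added at
the bottom. -/
def mu (m l : ℕ) (I : Finset ℕ) : List ℕ :=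
  (List.range' 1 l).map (fun i => m + 1 - i) ++
    ((List.range' 1 l).filter (· ∈ I)).map (row l)

/-- `μ_{l,+}^I`: the same with the lines of `ρ_{l,+}`. -/
def muPlus (m l : ℕ) (I : Finset ℕ) : List ℕ :=
  (List.range' 1 l).map (fun i => m + 1 - i) ++
    ((List.range' 1 l).filter (· ∈ I)).map (rowPlus l)

/-- The exponent of the sign: the sum of the lengths, in `ρ_l`, of the lines in `I`. -/
def sgn (l : ℕ) (I : Finset ℕ) : ℕ := ∑ i ∈ I, row l i

end

end LagrangianMirror

/-! Work with an arbitrary `g` in the spin group and compute the minor in the Clifford algebra.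
Since `Φ` is invariant, the entry of `g` in row `m+1+s` and a column `x` is `2Φ(x, u_s)`, where
`u_s` is `g⁻¹ v_{m+1-s}` up to sign. The minor is therefore the scalar left when the product `u_0 ⋯
u_m` is contracted with the forms `2Φ(x, ·)` of all its columns (`contractList_prod_ofFn`), and a
scalar can be read off as a vacuum expectation in the spin representation.

Contraction with `2Φ(x, ·)` is the supercommutator with `x` (`contractLeft_polarForm`). Expanding it
for the `l` columns of index at most `m` gives a signed sum over subsets `I`: the vectors indexed by
`I` stand to the left of `u_0 ⋯ u_m`, the others to the right (`contractList_range'`). The other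
columns are `v_{m+1}`, which contributes a scalar, and vectors `v̄_i`, which kill the vacuum and so
act only from the left (`minor_eq_vac`).

The product `u_0 ⋯ u_m` equals `g⁻¹ (v_{m+1} v_m ⋯ v_1) g` up to sign, and `v_m ⋯ v_1` sends `ω` to
its degree zero part times the top form. So it acts with rank one (`spinRep_rowProd`), and every
term splits into two matrix coefficients. The right-hand vectors give `p` of the diagram with the
lines in `I` removed. The left-hand ones give a coefficient of `g⁻¹` at the top form; the invariant
pairing turns it into a coefficient of `g` (`vac_prod_mul_inv_vol`), in which the `v̄_i` strip the
top form down to `v_1 ∧ ⋯ ∧ v_l`, the diagram `μ_l`, with the lines in `I` adjoined. -/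

namespace LagrangianMirror

open CliffordAlgebra

/-! ### Iterated contractions in a Clifford algebra -/

section Contraction

variable {R M : Type*} [CommRing R] [AddCommGroup M] [Module R M] {q : QuadraticForm R M}

/-- Contraction with a list of linear forms, the head of the list first. -/
noncomputable def contractList :
    List (Module.Dual R M) → CliffordAlgebra q →ₗ[R] CliffordAlgebra q
  | [] => LinearMap.id
  | d :: L => contractList L ∘ₗ contractLeft d

theorem contractList_nil (x : CliffordAlgebra q) : contractList [] x = x := rfl

theorem contractList_cons (d : Module.Dual R M) (L : List (Module.Dual R M))
    (x : CliffordAlgebra q) :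
    contractList (d :: L) x = contractList L (contractLeft d x) := rfl

theorem contractList_append (L L' : List (Module.Dual R M)) (x : CliffordAlgebra q) :
    contractList (L ++ L') x = contractList L' (contractList L x) := by
  induction L generalizing x with
  | nil => rfl
  | cons d L ih => simp only [List.cons_append, contractList_cons, ih]

theorem involute_contractLeft_apply (d : Module.Dual R M) (x : CliffordAlgebra q) :
    involute (contractLeft d x) = -contractLeft d (involute x) := by
  induction x using CliffordAlgebra.left_induction with
  | algebraMap r => simp
  | add _ _ hx hy => rw [map_add, map_add, hx, hy, map_add, map_add, neg_add]
  | ι_mul x w hx =>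
    rw [contractLeft_ι_mul, map_sub, map_smul, map_mul, map_mul, involute_ι, hx,
      neg_mul (ι q w) (involute x), map_neg (contractLeft d), contractLeft_ι_mul]
    noncomm_ring

theorem contractLeft_prod_ofFn {n : ℕ} (d : Module.Dual R M) (u : Fin (n + 1) → M) :
    contractLeft d (List.ofFn fun i => ι q (u i)).prod
      = ∑ j : Fin (n + 1), ((-1) ^ (j : ℕ) * d (u j)) •
          (List.ofFn fun i => ι q (u (j.succAbove i))).prod := by
  induction n with
  | zero => simp [contractLeft_ι, Algebra.algebraMap_eq_smul_one]
  | succ n ih =>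
    rw [List.ofFn_succ, List.prod_cons, contractLeft_ι_mul, ih, Finset.mul_sum, sub_eq_add_neg,
      ← Finset.sum_neg_distrib, Fin.sum_univ_succ (n := n + 1)]
    congr 1
    · simp
    · refine Finset.sum_congr rfl fun j _ => ?_
      rw [List.ofFn_succ, List.prod_cons, mul_smul_comm, ← neg_smul]
      simp [pow_succ]

/-- Contraction is an antiderivation, so each contraction is a Laplace expansion along the first
row. No orthogonality of the vectors is needed. -/
theorem contractList_prod_ofFn {n : ℕ} (d : Fin n → Module.Dual R M) (u : Fin n → M) :
    contractList (List.ofFn d) (List.ofFn fun i => ι q (u i)).prod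
      = algebraMap R _ (Matrix.of fun s t => d s (u t)).det := by
  induction n with
  | zero => simp [contractList_nil]
  | succ n ih =>
    rw [List.ofFn_succ, contractList_cons, contractLeft_prod_ofFn, map_sum,
      Matrix.det_succ_row_zero, map_sum]
    refine Finset.sum_congr rfl fun j _ => ?_
    rw [map_smul, ih, map_mul, Algebra.smul_def]
    rfl

theorem contractLeft_list_prod_mul (d : Module.Dual R M) (L : List M) (h : ∀ x ∈ L, d x = 0)
    (y : CliffordAlgebra q) :
    contractLeft d ((L.map (ι q)).prod * y)
      = (-1 : R) ^ L.length • ((L.map (ι q)).prod * contractLeft d y) := by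
  induction L with
  | nil => simp
  | cons x L ih =>
    rw [List.map_cons, List.prod_cons, mul_assoc, contractLeft_ι_mul, h x (by simp),
      ih fun z hz => h z (by simp [hz]), zero_smul, zero_sub, List.length_cons, pow_succ,
      mul_smul_comm, mul_assoc, ← neg_smul]
    simp

end Contraction

/-! ### Products of anticommuting elements -/

theorem prod_mul_of_anticommute {A : Type*} [Ring A] (x : A) (L : List A)
    (h : ∀ z ∈ L, z * x = -(x * z)) : L.prod * x = (-1 : A) ^ L.length * (x * L.prod) := by
  induction L with
  | nil => simp
  | cons z L ih =>
    rw [List.prod_cons, mul_assoc, ih fun z hz => h z (by simp [hz]), List.length_cons, pow_succ,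
      ((Commute.neg_one_left z).pow_left _).symm.left_comm, ← mul_assoc z x, h z (by simp)]
    noncomm_ring

theorem prod_mul_eq_zero_of_mem {A : Type*} [Ring A] (x : A) (L : List A) (hx : x ∈ L)
    (h : ∀ z ∈ L, z * x = -(x * z)) (h0 : x * x = 0) : L.prod * x = 0 := by
  induction L with
  | nil => simp at hx
  | cons z L ih =>
    have h' : ∀ z ∈ L, z * x = -(x * z) := fun z hz => h z (by simp [hz])
    rw [List.prod_cons, mul_assoc]
    rcases List.mem_cons.1 hx with rfl | hx
    · rw [prod_mul_of_anticommute x L h', ((Commute.neg_one_left x).pow_left _).symm.left_comm,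
        ← mul_assoc x x, h0]
      simp
    · rw [ih hx h', mul_zero]

/-! ### Contraction as a supercommutator, and its iteration -/

/-- The linear form `2 Φ(x, ·)` on `V`. -/
noncomputable def polarForm (m : ℕ) (x : V m) : Module.Dual ℂ (V m) := (2 : ℂ) • Phi m x

theorem polarForm_apply (m : ℕ) (x z : V m) : polarForm m x z = 2 * Phi m x z := rfl

theorem contractLeft_polarForm {m : ℕ} (x : V m) (X : Cl m) :
    contractLeft (polarForm m x) X = ι (Q m) x * X - involute X * ι (Q m) x := by
  induction X using CliffordAlgebra.left_induction with
  | algebraMap r => rw [contractLeft_algebraMap, AlgHom.commutes, Algebra.commutes, sub_self]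
  | add _ _ hx hy => rw [map_add, map_add, hx, hy]; noncomm_ring
  | ι_mul X z hX =>
    rw [contractLeft_ι_mul, hX, map_mul, involute_ι, polarForm_apply, Algebra.smul_def,
      ← anticomm]
    noncomm_ring

/-- Each supercommutator puts its vector on the left of `X` with coefficient `1`, or on the right
with coefficient `(-1)^r η`, where `r = t + n - i` contractions remain at index `i`. The prefactor
is the sign of the term with all vectors on the right; moving `i` into `I` divides by its own sign.
The parity of `X` enters through `η`, which stays constant because parity and the number of
remaining contractions change together. -/
theorem contractList_range' {m : ℕ} (e : ℕ → V m) (n t : ℕ) (X : Cl m) (η : ℂ) (hη : η * η = 1)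
    (hX : involute X = ((-1) ^ (n + 1) * η) • X) :
    contractList ((List.range' t n).map fun i => polarForm m (e i)) X
      = ((-1) ^ (∑ i ∈ Finset.range (n + 1), i) * η ^ n) •
        ∑ I ∈ (Finset.Ico t (t + n)).powerset, ((-1) ^ (∑ i ∈ I, (t + n - i)) * η ^ I.card) •
          (((((List.range' t n).filter (· ∈ I)).map fun i => ι (Q m) (e i)).reverse.prod * X) *
            (((List.range' t n).filter (· ∉ I)).map fun i => ι (Q m) (e i)).prod) := by
  induction n generalizing t X with
  | zero => simp [contractList_nil]
  | succ n ih =>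
    have hx : involute (ι (Q m) (e t) * X) = ((-1) ^ (n + 1) * η) • (ι (Q m) (e t) * X) := by
      rw [map_mul, involute_ι, hX, mul_smul_comm, pow_succ _ (n + 1), neg_mul, smul_neg, ← neg_smul]
      ring_nf
    have hx' : involute (X * ι (Q m) (e t)) = ((-1) ^ (n + 1) * η) • (X * ι (Q m) (e t)) := by
      rw [map_mul, involute_ι, hX, smul_mul_assoc, mul_neg, pow_succ _ (n + 1), smul_neg, ← neg_smul]
      congr 1
      ring
    have hI : Finset.Ico t (t + (n + 1)) = insert t (Finset.Ico (t + 1) (t + 1 + n)) := by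
      ext i; simp only [Finset.mem_Ico, Finset.mem_insert]; omega
    have ht : t ∉ Finset.Ico (t + 1) (t + 1 + n) := by simp
    -- The two halves of the first supercommutator correspond to the subsets with and without `t`.
    -- The vector at `t` ends up next to `X` on either side, hence the reversed order of the left
    -- block.
    rw [List.range'_succ, List.map_cons, contractList_cons, contractLeft_polarForm, hX,
      smul_mul_assoc, map_sub, map_smul, ih (t + 1) _ hx, ih (t + 1) _ hx', hI,
      Finset.sum_powerset_insert ht, ← Finset.sum_add_distrib, Finset.smul_sum, Finset.smul_sum,
      Finset.smul_sum, Finset.smul_sum, ← Finset.sum_sub_distrib]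
    refine Finset.sum_congr rfl fun I hI => ?_
    have htI : t ∉ I := fun h => ht (Finset.mem_powerset.1 hI h)
    have hf : ∀ i ∈ List.range' (t + 1) n, (i ∈ insert t I ↔ i ∈ I) := by
      intro i hi
      have : i ≠ t := by rintro rfl; simp at hi
      simp [this]
    have f1 : (List.range' (t + 1) n).filter (· ∈ insert t I)
        = (List.range' (t + 1) n).filter (· ∈ I) :=
      List.filter_congr fun i hi => by simp only [hf i hi]
    have f2 : (List.range' (t + 1) n).filter (· ∉ insert t I)
        = (List.range' (t + 1) n).filter (· ∉ I) :=
      List.filter_congr fun i hi => by simp only [hf i hi]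
    have e1 : ∀ i, t + (n + 1) - i = t + 1 + n - i := fun i => by omega
    simp only [List.filter_cons, Finset.mem_insert_self, htI, not_true_eq_false, not_false_eq_true,
      decide_true, decide_false, if_true, if_false, f1, f2, Finset.sum_insert htI,
      Finset.card_insert_of_notMem htI, List.map_cons, List.reverse_cons, List.prod_append,
      List.prod_cons, List.prod_nil, mul_one, e1, Bool.false_eq_true, smul_smul, mul_assoc]
    have hr : ∑ i ∈ Finset.range (n + 1 + 1), i = ∑ i ∈ Finset.range (n + 1), i + (n + 1) :=
      Finset.sum_range_succ (fun i => i) (n + 1)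
    rw [hr, sub_eq_add_neg, ← neg_smul, smul_add, smul_smul, smul_smul,
      add_comm ((_ : ℂ) • (_ : Cl m)) _]
    generalize (∑ i ∈ I, (t + 1 + n - i)) = s
    have h2 : ((-1 : ℂ) ^ n) * (-1) ^ n = 1 := by rw [← mul_pow]; simp
    congr 2
    · ring
    · rw [show t + 1 + n - t = n + 1 by omega]
      simp only [pow_add, pow_succ, mul_assoc]
      linear_combination (-(-1 : ℂ) ^ (∑ i ∈ Finset.range (n + 1), i) * η ^ n * (-1) ^ s *
        η ^ I.card) * (h2 * η * η + hη)

/-! ### The action of the basis vectors on the spin representation -/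

theorem spinRep_ι (m : ℕ) (x : V m) : spinRep m (ι (Q m) x) = cliffordAction m x :=
  CliffordAlgebra.lift_ι_apply _ _ _

theorem cliffordAction_anticomm (m : ℕ) (x z : V m) (h : Phi m x z = 0) :
    cliffordAction m z * cliffordAction m x = -(cliffordAction m x * cliffordAction m z) := by
  rw [← spinRep_ι, ← spinRep_ι, ← map_mul, swap_of_orth h, map_neg, map_mul]

theorem projW_v (m i : ℕ) : projW m (v m i) = vW m i := rfl

theorem projW_v_of_lt (m i : ℕ) (hi : m < i) : projW m (v m i) = 0 := by
  ext k
  have : k.val + 1 ≠ i := by omega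
  simp [projW, v, this]

theorem mid_v (m i : ℕ) : mid m (v m i) = if i = m + 1 then 1 else 0 := by
  simp [mid, v, eq_comm]

theorem incl_vW (m i : ℕ) (hi : i ≤ m) : incl m (vW m i) = v m i := by
  ext k
  by_cases h : k.val < m
  · simp [incl, h, v, vW]
  · have : k.val + 1 ≠ i := by omega
    simp [incl, h, v, this]

theorem eq_sum_vW (m : ℕ) (x : W m) : x = ∑ i : Fin m, x i • vW m (i.val + 1) := by
  ext k
  simp [vW, Fin.val_inj]

theorem polarForm_incl_eq_zero (m i : ℕ) (hi : i ≤ m + 1) :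
    polarForm m (v m i) ∘ₗ incl m = 0 := by
  ext x
  simp only [LinearMap.coe_comp, Function.comp_apply, LinearMap.zero_comp, LinearMap.zero_apply,
    LinearMap.coe_single]
  rw [eq_sum_vW m (Pi.single x 1), map_sum, map_sum]
  refine Finset.sum_eq_zero fun k _ => ?_
  rw [map_smul, map_smul, incl_vW m _ (by omega), polarForm_apply,
    Phi_v_v_eq_zero _ _ _ (by omega), mul_zero, smul_zero]

theorem cliffordAction_v_le (m i : ℕ) (hi : i ≤ m) (ω : VSpin m) :
    cliffordAction m (v m i) ω = ExteriorAlgebra.ι ℂ (vW m i) * ω := by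
  have h := polarForm_incl_eq_zero m i (by omega)
  rw [polarForm] at h
  rw [cliffordAction_apply, projW_v m i, mid_v, if_neg (by omega), h]
  simp

theorem cliffordAction_v_mid (m : ℕ) (ω : VSpin m) :
    cliffordAction m (v m (m + 1)) ω
      = ((Real.sqrt 2 : ℝ) : ℂ)⁻¹ • CliffordAlgebra.involute (Q := 0) ω := by
  have h := polarForm_incl_eq_zero m (m + 1) le_rfl
  rw [polarForm] at h
  rw [cliffordAction_apply, projW_v_of_lt m _ (by omega), mid_v, if_pos rfl, h]
  simp

theorem cliffordAction_v_bar (m i : ℕ) (hi : m + 1 < i) (ω : VSpin m) :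
    cliffordAction m (v m i) ω
      = CliffordAlgebra.contractLeft (Q := 0) (polarForm m (v m i) ∘ₗ incl m) ω := by
  rw [cliffordAction_apply, projW_v_of_lt m _ (by omega), mid_v, if_neg (by omega)]
  simp [polarForm]

/-- The vector `v_{m+2+t}` is `v̄_{m-t}`, so among the `v_i` it pairs only with `v_{m-t}`. -/
theorem polarForm_bar_vW (m t i : ℕ) (ht : t < m) (hi : i ≤ m) :
    (polarForm m (v m (m + 2 + t)) ∘ₗ incl m) (vW m i) = if i = m - t then (-1) ^ (t + 1) else 0 := by
  rw [LinearMap.comp_apply, incl_vW m i hi, polarForm_apply,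
    Phi_v_left m _ (by omega) (by omega)]
  have h1 : (-1 : ℂ) ^ (m + (m + 2 + t - 1)) = (-1) ^ (t + 1) := by
    rw [show m + (m + 2 + t - 1) = 2 * m + (t + 1) by omega, pow_add, pow_mul]; simp
  have h2 : 2 * m + 1 - (m + 2 + t) + 1 = i ↔ i = m - t := by omega
  simp only [v, h2, h1]
  split_ifs <;> ring

theorem eq_sum_bar (m : ℕ) (d : Module.Dual ℂ (W m)) :
    d = ∑ t : Fin m, (d (vW m (m - t.val)) * (-1) ^ (t.val + 1)) •
      (polarForm m (v m (m + 2 + t.val)) ∘ₗ incl m) := by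
  refine LinearMap.ext fun x => ?_
  rw [eq_sum_vW m x, map_sum, map_sum]
  refine Finset.sum_congr rfl fun k _ => ?_
  rw [map_smul, map_smul, LinearMap.sum_apply, Finset.sum_eq_single k.rev]
  · have hk := Fin.val_rev k
    rw [LinearMap.smul_apply, polarForm_bar_vW m _ _ (by omega) (by omega), if_pos (by omega),
      show m - k.rev.val = k.val + 1 by omega, smul_eq_mul, smul_eq_mul,
      smul_eq_mul, mul_assoc (d _), ← mul_pow]
    simp
  · intro t _ ht
    have hk := Fin.val_rev k
    have : k.val + 1 ≠ m - t.val := fun h => ht (by ext; omega)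
    rw [LinearMap.smul_apply, polarForm_bar_vW m _ _ (by omega) (by omega), if_neg this, smul_zero]
  · simp

/-! ### The top form and the functional dual to it -/

/-- The degree zero part of an element of the spin representation. -/
noncomputable abbrev vac (m : ℕ) : VSpin m →ₐ[ℂ] ℂ := ExteriorAlgebra.algebraMapInv

/-- The top form `v_m ∧ ⋯ ∧ v_1`. -/
noncomputable def vol (m : ℕ) : VSpin m :=
  ((List.range m).map fun s => ExteriorAlgebra.ι ℂ (vW m (m - s))).prod

/-- The operator `v̄_m v̄_{m-1} ⋯ v̄_{m+1-r}` on the spin representation. -/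
noncomputable def bars (m r : ℕ) : Module.End ℂ (VSpin m) :=
  ((List.range r).map fun t => cliffordAction m (v m (m + 2 + t))).prod

theorem vac_ι (m : ℕ) (x : W m) : vac m (ExteriorAlgebra.ι ℂ x) = 0 := by
  simp [ExteriorAlgebra.algebraMapInv]

theorem ι_anticomm (m : ℕ) (x z : W m) :
    ExteriorAlgebra.ι ℂ z * ExteriorAlgebra.ι ℂ x
      = -(ExteriorAlgebra.ι ℂ x * ExteriorAlgebra.ι ℂ z) :=
  eq_neg_of_add_eq_zero_left (ExteriorAlgebra.ι_add_mul_swap z x)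

theorem vol_mul_ι (m : ℕ) (x : W m) : vol m * ExteriorAlgebra.ι ℂ x = 0 := by
  rw [eq_sum_vW m x, map_sum, Finset.mul_sum]
  refine Finset.sum_eq_zero fun k _ => ?_
  rw [map_smul, mul_smul_comm, vol, prod_mul_eq_zero_of_mem, smul_zero]
  · exact List.mem_map.2 ⟨m - (k.val + 1), List.mem_range.2 (by omega), by
      rw [show m - (m - (k.val + 1)) = k.val + 1 by omega]⟩
  · intro z hz
    obtain ⟨s, -, rfl⟩ := List.mem_map.1 hz
    exact ι_anticomm m _ _
  · exact ExteriorAlgebra.ι_sq_zero _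

/-- The top form times any vector vanishes, so only the scalar part of `ω` survives. This is the
source of the rank one operator. -/
theorem vol_mul (m : ℕ) (ω : VSpin m) : vol m * ω = vac m ω • vol m := by
  induction ω using CliffordAlgebra.left_induction with
  | algebraMap r => rw [AlgHom.commutes, ← Algebra.commutes, Algebra.smul_def]; rfl
  | add _ _ hx hy => rw [mul_add, hx, hy, map_add, add_smul]
  | ι_mul x z hx =>
    have h1 := vol_mul_ι m z
    have h2 := vac_ι m z
    rw [ExteriorAlgebra.ι] at h1 h2
    rw [← mul_assoc, h1, map_mul, h2, zero_mul, zero_mul, zero_smul]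

theorem bars_succ (m r : ℕ) (ω : VSpin m) :
    bars m (r + 1) ω = bars m r (cliffordAction m (v m (m + 2 + r)) ω) := by
  simp [bars, List.range_succ]

/-- The operator `v̄_{m-r}` passes `r` factors with sign `(-1)^r` and then pairs with `v_{m-r}` to
give `(-1)^(r+1)`. Each step thus costs a single sign. -/
theorem bars_apply_prod_mul (m r : ℕ) (hr : r ≤ m) (X : VSpin m)
    (hX : ∀ t < r, cliffordAction m (v m (m + 2 + t)) X = 0) :
    bars m r (((List.range r).map fun s => ExteriorAlgebra.ι ℂ (vW m (m - s))).prod * X)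
      = (-1 : ℂ) ^ r • X := by
  induction r generalizing X with
  | zero => simp [bars]
  | succ r ih =>
    have hz : ∀ x ∈ (List.range r).map fun s => vW m (m - s),
        (polarForm m (v m (m + 2 + r)) ∘ₗ incl m) x = 0 := by
      intro x hx
      obtain ⟨s, hs, rfl⟩ := List.mem_map.1 hx
      rw [List.mem_range] at hs
      rw [polarForm_bar_vW m _ _ (by omega) (by omega), if_neg (by omega)]
    have key := contractLeft_list_prod_mul (q := 0) _ _ hz
      (ExteriorAlgebra.ι ℂ (vW m (m - r)) * X)
    have h1 : contractLeft (Q := 0) (polarForm m (v m (m + 2 + r)) ∘ₗ incl m)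
        (ExteriorAlgebra.ι ℂ (vW m (m - r)) * X) = (-1 : ℂ) ^ (r + 1) • X := by
      have h := hX r (by omega)
      rw [cliffordAction_v_bar m _ (by omega)] at h
      rw [ExteriorAlgebra.ι, contractLeft_ι_mul, h,
        polarForm_bar_vW m _ _ (by omega) (by omega), if_pos rfl, mul_zero, sub_zero]
    rw [h1, List.map_map, List.length_map, List.length_range] at key
    rw [bars_succ, cliffordAction_v_bar m _ (by omega), List.range_succ, List.map_append,
      List.prod_append, List.map_singleton, List.prod_singleton, mul_assoc]
    refine (congrArg (bars m r) key).trans ?_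
    rw [map_smul, mul_smul_comm, map_smul]
    rw [show bars m r ((List.map (⇑(ι 0) ∘ fun s => vW m (m - s)) (List.range r)).prod * X)
      = (-1 : ℂ) ^ r • X from ih (by omega) X fun t ht => hX t (by omega), smul_smul, smul_smul, pow_succ]
    congr 1
    have h2 : ((-1 : ℂ) ^ r) * (-1) ^ r = 1 := by rw [← mul_pow]; simp
    linear_combination (-(-1 : ℂ) ^ r) * h2

theorem cliffordAction_bar_one (m t : ℕ) :
    cliffordAction m (v m (m + 2 + t)) 1 = 0 := by
  rw [cliffordAction_v_bar m _ (by omega)]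
  exact contractLeft_one (Q := (0 : QuadraticForm ℂ (W m))) _

theorem bars_vol (m r : ℕ) (hr : r ≤ m) :
    bars m r (vol m) = (-1 : ℂ) ^ r •
      ((List.range (m - r)).map fun s => ExteriorAlgebra.ι ℂ (vW m (m - r - s))).prod := by
  have h := bars_apply_prod_mul m r hr
    ((List.range (m - r)).map fun s => ExteriorAlgebra.ι ℂ (vW m (m - r - s))).prod ?_
  · rw [← h, vol]
    congr 1
    rw [show List.range m = List.range r ++ (List.range (m - r)).map (r + ·) by
      rw [← List.range_add]; congr; omega, List.map_append, List.prod_append, List.map_map]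
    simp [Function.comp_def, Nat.sub_sub]
  · intro t ht
    have key := contractLeft_list_prod_mul (q := 0) (polarForm m (v m (m + 2 + t)) ∘ₗ incl m)
      ((List.range (m - r)).map fun s => vW m (m - r - s)) (by
        intro x hx
        obtain ⟨s, hs, rfl⟩ := List.mem_map.1 hx
        rw [List.mem_range] at hs
        rw [polarForm_bar_vW m _ _ (by omega) (by omega), if_neg (by omega)]) 1
    rw [contractLeft_one, mul_zero, smul_zero, mul_one, List.map_map] at key
    rw [cliffordAction_v_bar m _ (by omega)]
    exact key

/-- The functional on the spin representation that picks out the top form, up to sign. -/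
noncomputable def topCoeff (m : ℕ) : VSpin m →ₗ[ℂ] ℂ := (vac m).toLinearMap ∘ₗ bars m m

theorem topCoeff_vol (m : ℕ) : topCoeff m (vol m) = (-1) ^ m := by
  rw [topCoeff, LinearMap.comp_apply, bars_vol m m le_rfl, map_smul]
  simp

/-- A contraction is a combination of the operators `v̄_i`, and each of them already occurs in `bars
m m` and squares to zero. -/
theorem topCoeff_contractLeft (m : ℕ) (d : Module.Dual ℂ (W m)) (ω : VSpin m) :
    topCoeff m (contractLeft (Q := 0) d ω) = 0 := by
  rw [eq_sum_bar m d, map_sum, LinearMap.sum_apply, map_sum]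
  refine Finset.sum_eq_zero fun t _ => ?_
  rw [map_smul, LinearMap.smul_apply, map_smul, ← cliffordAction_v_bar m _ (by omega), topCoeff,
    LinearMap.comp_apply, bars, ← Module.End.mul_apply, prod_mul_eq_zero_of_mem]
  · simp
  · exact List.mem_map.2 ⟨t, List.mem_range.2 t.2, rfl⟩
  · intro z hz
    obtain ⟨s, -, rfl⟩ := List.mem_map.1 hz
    exact cliffordAction_anticomm m _ _ (Phi_v_v_eq_zero _ _ _ (by omega))
  · rw [cliffordAction_sq, Q_apply, Phi_v_v_eq_zero _ _ _ (by omega), map_zero]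

theorem bars_involute (m r : ℕ) (ω : VSpin m) :
    bars m r (involute (Q := 0) ω) = (-1 : ℂ) ^ r • involute (Q := 0) (bars m r ω) := by
  induction r generalizing ω with
  | zero => simp [bars]
  | succ r ih =>
    have h := involute_contractLeft (polarForm m (v m (m + 2 + r)) ∘ₗ incl m) ω
    rw [bars_succ, bars_succ, cliffordAction_v_bar m _ (by omega),
      cliffordAction_v_bar m _ (by omega), ← neg_neg (contractLeft _ (involute _)), ← h, map_neg, ih,
      pow_succ]
    simp

theorem vac_involute (m : ℕ) (ω : VSpin m) : vac m (involute (Q := 0) ω) = vac m ω := by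
  induction ω using CliffordAlgebra.left_induction with
  | algebraMap r => rw [AlgHom.commutes]
  | add _ _ hx hy => rw [map_add, map_add, map_add, hx, hy]
  | ι_mul x z hx =>
    have h2 := vac_ι m z
    rw [ExteriorAlgebra.ι] at h2
    rw [map_mul, map_mul (vac m), map_mul (vac m), involute_ι, map_neg, h2, neg_zero, zero_mul, zero_mul]

theorem topCoeff_involute (m : ℕ) (ω : VSpin m) :
    topCoeff m (involute (Q := 0) ω) = (-1) ^ m * topCoeff m ω := by
  rw [topCoeff, LinearMap.comp_apply, bars_involute, map_smul, LinearMap.comp_apply, smul_eq_mul]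
  exact congrArg _ (vac_involute m _)

/-! ### The invariant pairing on the spin representation -/

section InvolutePow

variable {R M : Type*} [CommRing R] [AddCommGroup M] [Module R M] {q : QuadraticForm R M}

theorem involute_pow_succ (k : ℕ) (x : CliffordAlgebra q) :
    ((involute : CliffordAlgebra q →ₐ[R] CliffordAlgebra q) ^ (k + 1)) x
      = involute ((involute ^ k : CliffordAlgebra q →ₐ[R] CliffordAlgebra q) x) := by
  rw [pow_succ']; rfl

theorem involute_pow_ι (k : ℕ) (x : M) :
    (involute ^ k : CliffordAlgebra q →ₐ[R] CliffordAlgebra q) (ι q x) = (-1 : R) ^ k • ι q x := by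
  induction k with
  | zero => simp
  | succ k ih => rw [involute_pow_succ, ih, map_smul, involute_ι, pow_succ]; simp

theorem involute_pow_prod (k : ℕ) (L : List M) :
    (involute ^ k : CliffordAlgebra q →ₐ[R] CliffordAlgebra q) (L.map (ι q)).prod
      = (-1 : R) ^ (k * L.length) • (L.map (ι q)).prod := by
  induction L with
  | nil => simp
  | cons x L ih =>
    rw [List.map_cons, List.prod_cons, map_mul, ih, involute_pow_ι, List.length_cons, mul_add,
      pow_add, mul_one, smul_mul_smul_comm, mul_comm ((-1 : R) ^ k)]

theorem involute_pow_contractLeft (k : ℕ) (d : Module.Dual R M) (x : CliffordAlgebra q) :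
    (involute ^ k : CliffordAlgebra q →ₐ[R] CliffordAlgebra q) (contractLeft d x)
      = (-1 : R) ^ k •
        contractLeft d ((involute ^ k : CliffordAlgebra q →ₐ[R] CliffordAlgebra q) x) := by
  induction k with
  | zero => simp
  | succ k ih =>
    rw [involute_pow_succ, involute_pow_succ, ih, map_smul, involute_contractLeft_apply, pow_succ]
    simp

theorem involute_pow_involute (k : ℕ) (x : CliffordAlgebra q) :
    (involute ^ k : CliffordAlgebra q →ₐ[R] CliffordAlgebra q) (involute x)
      = involute ((involute ^ k : CliffordAlgebra q →ₐ[R] CliffordAlgebra q) x) := by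
  induction k with
  | zero => simp
  | succ k ih => rw [involute_pow_succ, involute_pow_succ, ih]

theorem involute_pow_of_fixed (k : ℕ) (x : CliffordAlgebra q) (hx : involute x = x) :
    (involute ^ k : CliffordAlgebra q →ₐ[R] CliffordAlgebra q) x = x := by
  induction k with
  | zero => simp
  | succ k ih => rw [involute_pow_succ, ih, hx]

theorem reverse_prod_of_anticommute (L : List M)
    (h : ∀ x ∈ L, ∀ z ∈ L, x ≠ z → ι q z * ι q x = -(ι q x * ι q z)) (hL : L.Nodup) :
    reverse (L.map (ι q)).prod
      = (-1 : R) ^ (∑ i ∈ Finset.range L.length, i) • (L.map (ι q)).prod := by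
  induction L with
  | nil => simp
  | cons x L ih =>
    rw [List.nodup_cons] at hL
    rw [List.map_cons, List.prod_cons, reverse.map_mul, reverse_ι,
      ih (fun x hx z hz => h x (by simp [hx]) z (by simp [hz])) hL.2, smul_mul_assoc,
      prod_mul_of_anticommute, List.length_map, List.length_cons, Finset.sum_range_succ, pow_add,
      mul_smul]
    · congr 1
      rw [Algebra.smul_def]
      simp
    · intro z hz
      obtain ⟨z, hz', rfl⟩ := List.mem_map.1 hz
      exact h x (by simp) z (by simp [hz']) fun e => hL.1 (e ▸ hz')

end InvolutePow

/-- Integration by parts: the contraction is an antiderivation and `topCoeff` vanishes on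
contractions. The induction varies `ω'` so that vector factors of `ω` can be passed to it. -/
theorem topCoeff_reverse_contractLeft (m : ℕ) (d : Module.Dual ℂ (W m)) (ω ω' : VSpin m) :
    topCoeff m (reverse (Q := 0) (contractLeft (Q := 0) d ω) * ω')
      = topCoeff m (reverse (Q := 0) ω * contractLeft (Q := 0) d ω') := by
  induction ω using CliffordAlgebra.left_induction generalizing ω' with
  | algebraMap r =>
    rw [contractLeft_algebraMap, map_zero, zero_mul, map_zero, reverse.commutes,
      ← contractLeft_algebraMap_mul, topCoeff_contractLeft]
  | add _ _ hx hy => simp only [map_add, add_mul, hx, hy]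
  | ι_mul x z hx =>
    rw [contractLeft_ι_mul, map_sub, map_smul, reverse.map_mul, reverse.map_mul, reverse_ι,
      sub_mul, smul_mul_assoc, mul_assoc, mul_assoc, map_sub, hx, contractLeft_ι_mul, mul_sub,
      mul_smul_comm, map_sub]
    ring

/-- The pairing on the spin representation that is invariant under the spin group. -/
noncomputable def pairing (m : ℕ) (ω ω' : VSpin m) : ℂ :=
  topCoeff m (reverse (Q := 0)
    ((involute ^ m : CliffordAlgebra (0 : QuadraticForm ℂ (W m)) →ₐ[ℂ] _) ω) * ω')

theorem pairing_add_left (m : ℕ) (ω₁ ω₂ ω' : VSpin m) :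
    pairing m (ω₁ + ω₂) ω' = pairing m ω₁ ω' + pairing m ω₂ ω' := by
  simp only [pairing, map_add, add_mul]

theorem pairing_add_right (m : ℕ) (ω ω₁ ω₂ : VSpin m) :
    pairing m ω (ω₁ + ω₂) = pairing m ω ω₁ + pairing m ω ω₂ := by
  simp only [pairing, map_add, mul_add]

theorem pairing_smul_left (m : ℕ) (c : ℂ) (ω ω' : VSpin m) :
    pairing m (c • ω) ω' = c * pairing m ω ω' := by
  simp only [pairing, map_smul, smul_mul_assoc, smul_eq_mul]

theorem pairing_smul_right (m : ℕ) (c : ℂ) (ω ω' : VSpin m) :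
    pairing m ω (c • ω') = c * pairing m ω ω' := by
  simp only [pairing, map_smul, mul_smul_comm, smul_eq_mul]

/-- Without the twist by `involute ^ m`, multiplications and contractions would be self-adjoint,
while `v_{m+1}`, acting by the involution, would have adjoint sign `(-1)^m`. The twist gives all
vectors the same sign. -/
theorem pairing_cliffordAction (m : ℕ) (x : V m) (ω ω' : VSpin m) :
    pairing m (cliffordAction m x ω) ω' = (-1) ^ m * pairing m ω (cliffordAction m x ω') := by
  rw [cliffordAction_apply, cliffordAction_apply, pairing_add_left, pairing_add_left,
    pairing_add_right, pairing_add_right, mul_add, mul_add, pairing_smul_left, pairing_smul_right]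
  congr 1
  · congr 1
    · rw [pairing, pairing, ExteriorAlgebra.ι,
        map_mul (involute ^ m : CliffordAlgebra (0 : QuadraticForm ℂ (W m)) →ₐ[ℂ] _), involute_pow_ι, reverse.map_mul, map_smul,
        reverse_ι, mul_smul_comm, smul_mul_assoc, map_smul, smul_eq_mul, mul_assoc]
    · rw [mul_left_comm]
      congr 1
      rw [pairing, pairing, involute_pow_involute, reverse_involute, ← topCoeff_involute,
        map_mul (involute (Q := (0 : QuadraticForm ℂ (W m))))]
      congr 2
      exact (involute_involute ω').symm
  · rw [pairing, pairing, involute_pow_contractLeft, map_smul, smul_mul_assoc, map_smul,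
      smul_eq_mul, topCoeff_reverse_contractLeft]

theorem pairing_spinRep (m : ℕ) (X : Cl m) (ω ω' : VSpin m) :
    pairing m (spinRep m X ω) ω'
      = pairing m ω (spinRep m (reverse ((involute ^ m : Cl m →ₐ[ℂ] Cl m) X)) ω') := by
  induction X using CliffordAlgebra.left_induction generalizing ω ω' with
  | algebraMap r =>
    rw [AlgHom.commutes, AlgHom.commutes, reverse.commutes, AlgHom.commutes,
      Module.algebraMap_end_apply, Module.algebraMap_end_apply, pairing_smul_left,
      pairing_smul_right]
  | add _ _ hx hy =>
    simp only [map_add, LinearMap.add_apply, pairing_add_left, pairing_add_right, hx, hy]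
  | ι_mul x z hx =>
    rw [map_mul, Module.End.mul_apply, spinRep_ι, pairing_cliffordAction, hx, map_mul,
      involute_pow_ι, reverse.map_mul, map_smul, reverse_ι, map_mul, map_smul,
      Module.End.mul_apply, LinearMap.smul_apply, map_smul, pairing_smul_right, spinRep_ι]

/-! ### Pairing with the top form -/

theorem vW_ne (m i j : ℕ) (hi : 1 ≤ i) (hi' : i ≤ m) (h : i ≠ j) : vW m i ≠ vW m j := by
  intro e
  have := congrFun e ⟨i - 1, by omega⟩
  simp [vW, Nat.sub_add_cancel hi, h] at this

theorem vol_eq (m : ℕ) :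
    vol m = (((List.range m).map fun s => vW m (m - s)).map (ι (0 : QuadraticForm ℂ (W m)))).prod := by
  rw [List.map_map]; rfl

theorem reverse_vol (m : ℕ) :
    reverse (Q := 0) (vol m) = (-1 : ℂ) ^ (∑ i ∈ Finset.range m, i) • vol m := by
  have h := reverse_prod_of_anticommute (q := (0 : QuadraticForm ℂ (W m)))
    ((List.range m).map fun s => vW m (m - s)) (fun x _ z _ _ => ι_anticomm m x z) ?_
  · rw [← vol_eq, List.length_map, List.length_range] at h
    exact h
  · refine List.Nodup.map_on (fun s hs t ht e => ?_) List.nodup_range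
    rw [List.mem_range] at hs ht
    by_contra hst
    exact vW_ne m (m - s) (m - t) (by omega) (by omega) (by omega) e

theorem pairing_vol_right (m : ℕ) (ω : VSpin m) :
    pairing m ω (vol m) = (-1) ^ m * vac m ω := by
  have hs : ((-1 : ℂ) ^ (∑ i ∈ Finset.range m, i)) * (-1) ^ (∑ i ∈ Finset.range m, i) = 1 := by
    rw [← mul_pow]; simp
  have h : vol m = (-1 : ℂ) ^ (∑ i ∈ Finset.range m, i) • reverse (Q := 0) (vol m) := by
    rw [reverse_vol, smul_smul, hs, one_smul]
  have hv : ∀ k, vac m ((involute ^ k : CliffordAlgebra (0 : QuadraticForm ℂ (W m)) →ₐ[ℂ] _) ω)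
      = vac m ω := by
    intro k
    induction k with
    | zero => rfl
    | succ k ih => rw [involute_pow_succ, vac_involute, ih]
  rw [pairing, h, mul_smul_comm, ← reverse.map_mul, vol_mul, map_smul, map_smul,
    map_smul, reverse_vol, map_smul, topCoeff_vol, hv, smul_eq_mul, smul_eq_mul, smul_eq_mul]
  linear_combination ((-1) ^ m * vac m ω) * hs

theorem pairing_vol_left (m : ℕ) (ω : VSpin m) :
    pairing m (vol m) ω = (-1) ^ (∑ i ∈ Finset.range m, i) * vac m ω := by
  have h1 : ((-1 : ℂ) ^ (m * m)) * (-1) ^ m = 1 := by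
    rw [← pow_add]; exact Even.neg_one_pow (by rw [← Nat.mul_succ]; exact Nat.even_mul_succ_self m)
  have h := involute_pow_prod (q := (0 : QuadraticForm ℂ (W m))) m
    ((List.range m).map fun s => vW m (m - s))
  rw [← vol_eq, List.length_map, List.length_range] at h
  rw [pairing, h, map_smul, reverse_vol, smul_smul, smul_mul_assoc, vol_mul, map_smul, map_smul,
    topCoeff_vol, smul_eq_mul, smul_eq_mul]
  linear_combination ((-1) ^ (∑ i ∈ Finset.range m, i) * vac m ω) * h1

/-- Matrix coefficients at the top form, in terms of the reversed product. -/
theorem vac_prod_mul_inv_vol {m : ℕ} (g : Spin m) (L : List (V m)) :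
    vac m (spinRep m ((L.map (ι (Q m))).prod) (spinRep m ((g⁻¹ : Spin m) : Cl m) (vol m)))
      = (-1) ^ (m * L.length + ∑ i ∈ Finset.range (m + 1), i) *
        vac m (spinRep m (g : Cl m) (spinRep m ((L.map (ι (Q m))).reverse.prod) (vol m))) := by
  -- Elements of the spin group are even and their `star` is their inverse, so the pairing is
  -- invariant.
  have hg : reverse ((involute ^ m : Cl m →ₐ[ℂ] Cl m) ((g⁻¹ : Spin m) : Cl m)) = (g : Cl m) := by
    have h1 : star ((g⁻¹ : Spin m) : Cl m) = (g : Cl m) := by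
      rw [← spinGroup.star_eq_inv, spinGroup.coe_star, star_star]
    rw [involute_pow_of_fixed _ _ (spinGroup.involute_eq (g⁻¹).2), ← h1, star_def,
      spinGroup.involute_eq (g⁻¹).2]
  -- Pairing with the top form on either side extracts the degree zero part. Moving all operators to
  -- the other side exchanges `g⁻¹` for `g` and reverses the product.
  have h := pairing_vol_right m
    (spinRep m ((L.map (ι (Q m))).prod) (spinRep m ((g⁻¹ : Spin m) : Cl m) (vol m)))
  rw [pairing_spinRep, pairing_spinRep, hg, pairing_vol_left, involute_pow_prod, map_smul,
    reverse_prod_map_ι, map_smul, LinearMap.smul_apply, map_smul, map_smul, smul_eq_mul] at h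
  have h1 : ((-1 : ℂ) ^ m) * (-1) ^ m = 1 := by rw [← mul_pow]; simp
  rw [Finset.sum_range_succ, pow_add, pow_add]
  linear_combination (-(-1 : ℂ) ^ m) * h - vac m (spinRep m ((L.map (ι (Q m))).prod) (spinRep m ((g⁻¹ : Spin m) : Cl m) (vol m))) * h1

/-! ### The minors as vacuum expectations -/

theorem coe_mul_coe_inv {m : ℕ} (g : Spin m) : (g : Cl m) * ((g⁻¹ : Spin m) : Cl m) = 1 := by
  rw [← Submonoid.coe_mul, mul_inv_cancel, Submonoid.coe_one]

theorem coe_inv_mul_coe {m : ℕ} (g : Spin m) : ((g⁻¹ : Spin m) : Cl m) * (g : Cl m) = 1 := by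
  rw [← Submonoid.coe_mul, inv_mul_cancel, Submonoid.coe_one]

theorem vac_spinRep_algebraMap_one (m : ℕ) (c : ℂ) :
    vac m (spinRep m (algebraMap ℂ (Cl m) c) 1) = c := by
  rw [AlgHom.commutes, Module.algebraMap_end_apply, map_smul, map_one, smul_eq_mul, mul_one]

/-- The anticommutator of two vectors is a scalar, hence unchanged under conjugation by `g⁻¹`;
scalars are compared through their action on the vacuum. -/
theorem Phi_act_right {m : ℕ} (g : Spin m) (x z : V m) :
    Phi m x (act g z) = Phi m z (act g⁻¹ x) := by
  have h1 := anticomm m x (act g z)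
  have h2 := anticomm m z (act g⁻¹ x)
  have h3 : algebraMap ℂ (Cl m) (2 * Phi m x (act g z))
      = algebraMap ℂ (Cl m) (2 * Phi m z (act g⁻¹ x)) := by
    have e : algebraMap ℂ (Cl m) (2 * Phi m x (act g z))
        = (g⁻¹ : Spin m) * algebraMap ℂ (Cl m) (2 * Phi m x (act g z)) * g := by
      rw [← Algebra.commutes, mul_assoc, coe_inv_mul_coe, mul_one]
    rw [e, ← h1, ← h2, ι_act, ι_act, inv_inv]
    calc _ = ((g⁻¹ : Spin m) : Cl m) * ι (Q m) x * g * ι (Q m) z * (((g⁻¹ : Spin m) : Cl m) * g)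
          + (((g⁻¹ : Spin m) : Cl m) * g) * ι (Q m) z * (((g⁻¹ : Spin m) : Cl m) * ι (Q m) x * g) := by
            noncomm_ring
      _ = _ := by rw [coe_inv_mul_coe]; noncomm_ring
  have h4 := congrArg (fun X => vac m (spinRep m X 1)) h3
  simp only [vac_spinRep_algebraMap_one] at h4
  linear_combination h4 / 2

/-- The vector `(-1)^s g⁻¹ v_{m+1-s}`: up to sign, `2 Φ` pairs it with `x` to give the coordinate of
`g x` along `v_{m+1+s}`. -/
noncomputable def rowVector {m : ℕ} (g : Spin m) (s : ℕ) : V m :=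
  (-1 : ℂ) ^ s • act g⁻¹ (v m (m + 1 - s))

/-- The coordinate along `v_{m+1+s}` is, up to sign, `2Φ` with the opposite vector `v_{m+1-s}`, and
invariance moves `g` onto that vector. The factor `(-1)^s` in `rowVector` absorbs the sign of the
form. -/
theorem coord_act {m : ℕ} (g : Spin m) (s : ℕ) (hs : s ≤ m) (x : V m) :
    coord m (m + 1 + s) (act g x) = polarForm m x (rowVector g s) := by
  rw [polarForm_apply, rowVector, map_smul, ← Phi_act_right, Phi_v_left m _ (by omega) (by omega),
    coord, dif_pos ⟨by omega, by omega⟩, smul_eq_mul]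
  have h : (-1 : ℂ) ^ s * (-1) ^ (m + (m + 1 - s - 1)) = 1 := by
    rw [← pow_add]; exact Even.neg_one_pow ⟨m, by omega⟩
  have e : (⟨2 * m + 1 - (m + 1 - s), by omega⟩ : Fin (2 * m + 1)) = ⟨m + 1 + s - 1, by omega⟩ := by
    ext; simp; omega
  rw [e]
  linear_combination (-act g x ⟨m + 1 + s - 1, by omega⟩) * h

theorem prod_conj {m : ℕ} (g : Spin m) (L : List (V m)) :
    ((L.map fun x => act g x).map (ι (Q m))).prod
      = g * (L.map (ι (Q m))).prod * (g⁻¹ : Spin m) := by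
  induction L with
  | nil => simp [coe_mul_coe_inv]
  | cons x L ih =>
    rw [List.map_cons, List.map_cons, List.prod_cons, ih, ι_act, List.map_cons, List.prod_cons]
    calc _ = (g : Cl m) * ι (Q m) x * (((g⁻¹ : Spin m) : Cl m) * g) * (L.map (ι (Q m))).prod
          * (g⁻¹ : Spin m) := by noncomm_ring
      _ = _ := by rw [coe_inv_mul_coe]; noncomm_ring

theorem prod_neg_one_pow_smul {R A : Type*} [CommRing R] [Ring A] [Algebra R A] (f : ℕ → A)
    (n : ℕ) :
    ((List.range n).map fun s => (-1 : R) ^ s • f s).prod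
      = (-1 : R) ^ (∑ i ∈ Finset.range n, i) • ((List.range n).map f).prod := by
  induction n with
  | zero => simp
  | succ n ih =>
    rw [List.range_succ, List.map_append, List.prod_append, ih, Finset.sum_range_succ,
      List.map_append, List.prod_append, pow_add]
    simp [smul_smul, mul_comm]

/-! ### The product of the row vectors as a rank one operator -/

theorem spinRep_prod_le {m : ℕ} (L : List ℕ) (hL : ∀ i ∈ L, i ≤ m) (ω : VSpin m) :
    spinRep m (L.map fun i => ι (Q m) (v m i)).prod ω
      = (L.map fun i => ExteriorAlgebra.ι ℂ (vW m i)).prod * ω := by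
  induction L with
  | nil => simp
  | cons i L ih =>
    rw [List.map_cons, List.prod_cons, map_mul, Module.End.mul_apply,
      ih fun i hi => hL i (by simp [hi]), spinRep_ι, cliffordAction_v_le m i (hL i (by simp)),
      List.map_cons, List.prod_cons, mul_assoc]

/-- The product `u_0 u_1 ⋯ u_m` of the row vectors. -/
noncomputable def rowProd {m : ℕ} (g : Spin m) : Cl m :=
  ((List.range (m + 1)).map fun s => ι (Q m) (rowVector g s)).prod

theorem involute_vol (m : ℕ) : involute (Q := 0) (vol m) = (-1 : ℂ) ^ m • vol m := by
  have h := involute_prod_map_ι (Q := (0 : QuadraticForm ℂ (W m)))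
    ((List.range m).map fun s => vW m (m - s))
  rw [← vol_eq, List.length_map, List.length_range] at h
  exact h

/-- Conjugation by `g⁻¹` reduces to the product `v_{m+1} v_m ⋯ v_1`, whose last `m` factors act as
multiplication by the top form; `v_{m+1}` then only rescales. Rank one is what makes the minor
quadratic in the Plücker coordinates. -/
theorem spinRep_rowProd {m : ℕ} (g : Spin m) (ω : VSpin m) :
    spinRep m (rowProd g) ω
      = ((-1 : ℂ) ^ (∑ i ∈ Finset.range (m + 1), i) * (-1) ^ m * ((Real.sqrt 2 : ℝ) : ℂ)⁻¹ *
          vac m (spinRep m g ω)) • spinRep m (g⁻¹ : Spin m) (vol m) := by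
  have h1 : rowProd g = (-1 : ℂ) ^ (∑ i ∈ Finset.range (m + 1), i) • (((g⁻¹ : Spin m) : Cl m) *
      (ι (Q m) (v m (m + 1)) * (((List.range m).map fun s => m - s).map fun i =>
        ι (Q m) (v m i)).prod) * g) := by
    have h := prod_conj g⁻¹ ((List.range (m + 1)).map fun s => v m (m + 1 - s))
    rw [inv_inv, List.map_map, List.map_map] at h
    simp only [rowProd, rowVector, map_smul]
    rw [prod_neg_one_pow_smul]
    congr 1
    refine h.trans ?_
    rw [List.range_succ_eq_map]
    simp [Function.comp_def]
  have h2 : spinRep m (((List.range m).map fun s => m - s).map fun i => ι (Q m) (v m i)).prod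
      (spinRep m g ω) = vac m (spinRep m g ω) • vol m := by
    rw [spinRep_prod_le _ (by simp), ← vol_mul, vol, List.map_map]
    rfl
  rw [h1, map_smul, LinearMap.smul_apply, map_mul, map_mul, map_mul, Module.End.mul_apply,
    Module.End.mul_apply, Module.End.mul_apply, h2, spinRep_ι, cliffordAction_v_mid, map_smul,
    map_smul (involute (Q := (0 : QuadraticForm ℂ (W m)))), involute_vol, map_smul, map_smul,
    smul_smul, smul_smul, smul_smul]
  congr 1
  ring

theorem involute_rowProd {m : ℕ} (g : Spin m) :
    involute (rowProd g) = (-1 : ℂ) ^ (m + 1) • rowProd g := by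
  have h := involute_prod_map_ι (Q := Q m) ((List.range (m + 1)).map (rowVector g))
  rw [List.map_map, List.length_map, List.length_range] at h
  exact h

theorem involute_contractList {m : ℕ} (L : List (Module.Dual ℂ (V m))) (X : Cl m) :
    involute (contractList L X) = (-1 : ℂ) ^ L.length • contractList L (involute X) := by
  induction L generalizing X with
  | nil => simp [contractList_nil]
  | cons d L ih =>
    rw [contractList_cons, contractList_cons, ih, involute_contractLeft_apply, List.length_cons,
      pow_succ]
    simp

/-- In each supercommutator the half with `x` on the right kills the vacuum, so only left
multiplication remains. -/
theorem spinRep_contractList_one {m : ℕ} (L : List (V m)) (hL : ∀ x ∈ L, cliffordAction m x 1 = 0)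
    (X : Cl m) :
    spinRep m (contractList (L.map (polarForm m)) X) 1
      = spinRep m ((L.map (ι (Q m))).reverse.prod * X) 1 := by
  induction L generalizing X with
  | nil => simp [contractList_nil]
  | cons x L ih =>
    rw [List.map_cons, contractList_cons, ih fun z hz => hL z (by simp [hz]),
      contractLeft_polarForm, List.map_cons, List.reverse_cons, List.prod_append,
      List.prod_singleton, mul_sub, map_sub, LinearMap.sub_apply, ← mul_assoc, ← mul_assoc,
      map_mul _ _ (ι (Q m) x), Module.End.mul_apply, spinRep_ι, hL x (by simp), map_zero, sub_zero]

theorem ofFn_eq_map_range {α : Type*} (n : ℕ) (f : ℕ → α) :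
    (List.ofFn fun i : Fin n => f i) = (List.range n).map f := by
  refine List.ext_getElem (by simp) fun i h1 h2 => by simp

/-- The columns `e 1, …, e l, m+1, m+2, …, 2m+1-l`. -/
def columns (m l : ℕ) (e : ℕ → ℕ) (t : ℕ) : ℕ := if t < l then e (t + 1) else m + 1 + (t - l)

theorem map_columns {α : Type*} (m l : ℕ) (hl : l ≤ m) (e : ℕ → ℕ) (f : ℕ → α) :
    (List.range (m + 1)).map (fun t => f (columns m l e t))
      = (List.range' 1 l).map (fun i => f (e i)) ++
        (f (m + 1) :: (List.range (m - l)).map fun t => f (m + 2 + t)) := by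
  rw [show m + 1 = l + ((m - l) + 1) by omega, List.range_add, List.map_append,
    List.range'_eq_map_range, List.range_succ_eq_map, List.map_cons, List.map_cons, List.map_map,
    List.map_map, List.map_map]
  congr 1
  · refine List.map_congr_left fun t ht => ?_
    rw [List.mem_range] at ht
    simp [columns, ht, add_comm]
  · congr 1
    · simp [columns]; congr 1; omega
    · refine List.map_congr_left fun t ht => ?_
      simp [columns]; congr 1; omega

theorem minor_eq_vac {m : ℕ} (g : Spin m) (l : ℕ) (hl : l ≤ m) (e : ℕ → ℕ) :
    minor g (fun s : Fin (m + 1) => m + 1 + s.val) (fun t : Fin (m + 1) => columns m l e t)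
      = 2 * (-1) ^ (m - l) * ((Real.sqrt 2 : ℝ) : ℂ)⁻¹ *
        vac m (spinRep m ((((List.range (m - l)).map fun t => v m (m + 2 + t)).map
          (ι (Q m))).reverse.prod * contractList ((List.range' 1 l).map fun i =>
            polarForm m (v m (e i))) (rowProd g)) 1) := by
  set Y := contractList ((List.range' 1 l).map fun i => polarForm m (v m (e i))) (rowProd g) with hY
  -- `Y` comes from `m + 1` vectors by `l` contractions, so its parity is that of `m - l + 1`.
  have hYinv : involute Y = -((-1 : ℂ) ^ (m - l) • Y) := by
    rw [hY, involute_contractList, involute_rowProd, map_smul, smul_smul, ← neg_smul]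
    congr 1
    rw [List.length_map, List.length_range', ← pow_add,
      show l + (m + 1) = 2 * l + (m - l) + 1 by omega, pow_succ, pow_add, pow_mul]
    simp
  set K := (((List.range (m - l)).map fun t => v m (m + 2 + t)).map (ι (Q m))).reverse with hK
  have h1 : minor g (fun s : Fin (m + 1) => m + 1 + s.val)
      (fun t : Fin (m + 1) => columns m l e t)
      = vac m (spinRep m (contractList (List.ofFn fun t : Fin (m + 1) =>
          polarForm m (v m (columns m l e t))) (rowProd g)) 1) := by
    rw [rowProd, ← ofFn_eq_map_range, contractList_prod_ofFn, vac_spinRep_algebraMap_one, minor,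
      ← Matrix.det_transpose]
    congr 1
    ext s t
    exact coord_act g t (by omega) _
  have hanti : K.prod * ι (Q m) (v m (m + 1))
      = (-1 : Cl m) ^ (m - l) * (ι (Q m) (v m (m + 1)) * K.prod) := by
    rw [prod_mul_of_anticommute, hK]
    · simp
    · intro z hz
      rw [hK, List.mem_reverse, List.map_map] at hz
      obtain ⟨t, -, rfl⟩ := List.mem_map.1 hz
      exact swap_of_orth (Phi_v_v_eq_zero _ _ _ (by omega))
  have hmid : ∀ X : Cl m, vac m (spinRep m (ι (Q m) (v m (m + 1)) * X) 1)
      = ((Real.sqrt 2 : ℝ) : ℂ)⁻¹ * vac m (spinRep m X 1) := by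
    intro X
    rw [map_mul, Module.End.mul_apply, spinRep_ι, cliffordAction_v_mid, map_smul, vac_involute,
      smul_eq_mul]
  have hmid' : ∀ X : Cl m, vac m (spinRep m (X * ι (Q m) (v m (m + 1))) 1)
      = ((Real.sqrt 2 : ℝ) : ℂ)⁻¹ * vac m (spinRep m X 1) := by
    intro X
    have h : involute (Q := 0) (1 : VSpin m) = 1 := map_one _
    rw [map_mul, Module.End.mul_apply, spinRep_ι, cliffordAction_v_mid, h, map_smul, map_smul,
      smul_eq_mul]
  have h2 := spinRep_contractList_one ((List.range (m - l)).map fun t => v m (m + 2 + t)) (by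
    intro x hx
    obtain ⟨t, -, rfl⟩ := List.mem_map.1 hx
    exact cliffordAction_bar_one m t) (contractLeft (polarForm m (v m (m + 1))) Y)
  rw [h1, ofFn_eq_map_range (m + 1) (fun t => polarForm m (v m (columns m l e t))),
    map_columns m l hl e (fun i => polarForm m (v m i)), contractList_append, contractList_cons,
    ← hY]
  rw [List.map_map, ← hK] at h2
  refine (congrArg (vac m) h2).trans ?_
  have hp : (-1 : Cl m) ^ (m - l) = algebraMap ℂ _ ((-1) ^ (m - l)) := by simp
  -- Both halves of the supercommutator with `v_{m+1}` give the same value `(-1)^(m-l)/√2` times the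
  -- remaining expectation, hence the factor `2`.
  rw [contractLeft_polarForm, hYinv, neg_mul, sub_neg_eq_add, mul_add, ← mul_assoc, hanti,
    smul_mul_assoc, mul_smul_comm, ← mul_assoc K.prod, map_add, LinearMap.add_apply, map_add, hp,
    ← Algebra.smul_def, smul_mul_assoc, map_smul, map_smul, LinearMap.smul_apply,
    LinearMap.smul_apply, map_smul, map_smul, hmid', mul_assoc (ι (Q m) (v m (m + 1))), hmid]
  simp only [smul_eq_mul]
  ring

/-! ### Minors as quadratic expressions in the Plücker coordinates -/

theorem card_eq_length_filter (l : ℕ) (I : Finset ℕ) (hI : I ⊆ Finset.Icc 1 l) :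
    ((List.range' 1 l).filter (· ∈ I)).length = I.card := by
  rw [← List.toFinset_card_of_nodup ((List.nodup_range' (s := 1) (n := l)).filter _)]
  congr 1
  ext i
  simp only [List.mem_toFinset, List.mem_filter, List.mem_range'_1, decide_eq_true_eq]
  refine ⟨fun h => h.2, fun h => ⟨?_, h⟩⟩
  have := Finset.mem_Icc.1 (hI h)
  omega

theorem prod_vW_comm {m : ℕ} (L L' : List ℕ) :
    (L.map fun i => ExteriorAlgebra.ι ℂ (vW m i)).prod *
        (L'.map fun i => ExteriorAlgebra.ι ℂ (vW m i)).prod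
      = (-1 : ℂ) ^ (L.length * L'.length) •
        ((L'.map fun i => ExteriorAlgebra.ι ℂ (vW m i)).prod *
          (L.map fun i => ExteriorAlgebra.ι ℂ (vW m i)).prod) := by
  have hp : (-1 : VSpin m) ^ L.length = algebraMap ℂ _ ((-1) ^ L.length) := by simp
  induction L' with
  | nil => simp
  | cons i L' ih =>
    rw [List.map_cons, List.prod_cons, ← mul_assoc, prod_mul_of_anticommute, List.length_map, hp,
      ← Algebra.smul_def, smul_mul_assoc, mul_assoc, ih, mul_smul_comm, smul_smul, mul_assoc,
      List.length_cons, mul_add, mul_one, add_comm (_ * _), pow_add]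
    intro z hz
    obtain ⟨k, -, rfl⟩ := List.mem_map.1 hz
    exact ι_anticomm m _ _

theorem bars_vol_eq (m l : ℕ) (hl : l ≤ m) :
    bars m (m - l) (vol m) = ((-1 : ℂ) ^ (m - l) * (-1) ^ (∑ i ∈ Finset.range l, i)) •
      ((List.range' 1 l).map fun i => ExteriorAlgebra.ι ℂ (vW m i)).prod := by
  rw [bars_vol m _ (by omega), Nat.sub_sub_self hl, mul_smul]
  congr 1
  have h := reverse_prod_of_anticommute (q := (0 : QuadraticForm ℂ (W m)))
    ((List.range' 1 l).map fun i => vW m i) (fun x _ z _ _ => ι_anticomm m x z) ?_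
  · rw [reverse_prod_map_ι, List.length_map, List.length_range', ← List.map_reverse,
      ← List.map_reverse, List.reverse_range', List.map_map, List.map_map, List.map_map] at h
    rw [show (fun s => ExteriorAlgebra.ι ℂ (vW m (l - s)))
      = fun s => ExteriorAlgebra.ι ℂ (vW m (1 + l - 1 - s)) by simp]
    exact h
  · refine List.Nodup.map_on (fun s hs t ht e => ?_) List.nodup_range'
    rw [List.mem_range'_1] at hs ht
    by_contra hst
    exact vW_ne m s t (by omega) (by omega) hst e

/-- The subset expansion is matched term by term: the rank one operator separates the right block
`B` from the left block `A`, which stands with the `v̄_i`. -/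
theorem sum_vac_mul_vac_eq_minor {m : ℕ} (g : Spin m) (l : ℕ) (hl : l ≤ m) (e : ℕ → ℕ)
    (he : ∀ i, 1 ≤ i → i ≤ l → e i ≤ m) :
    ∑ I ∈ (Finset.Icc 1 l).powerset, (-1 : ℂ) ^ (∑ i ∈ I, (l + 1 - i)) *
      (vac m (spinRep m g ((((List.range' 1 l).filter (· ∉ I)).map e).map fun i =>
          ExteriorAlgebra.ι ℂ (vW m i)).prod) *
        vac m (spinRep m g (((List.range' 1 l ++ ((List.range' 1 l).filter (· ∈ I)).map e).map
          fun i => ExteriorAlgebra.ι ℂ (vW m i)).prod)))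
      = minor g (fun s : Fin (m + 1) => m + 1 + s.val)
          (fun t : Fin (m + 1) => columns m l e t) := by
  -- `rowProd g` has parity `m + 1`, while the expansion over `l` vectors asks for the sign
  -- `(-1)^(l+1) η`.
  set η : ℂ := (-1) ^ (m + l) with hη
  have hηη : η * η = 1 := by rw [hη, ← mul_pow]; simp
  have hinv : involute (rowProd g) = ((-1) ^ (l + 1) * η) • rowProd g := by
    rw [involute_rowProd, hη, ← pow_add, show l + 1 + (m + l) = 2 * l + (m + 1) by omega,
      pow_add _ (2 * l), pow_mul]
    simp
  have hIco : Finset.Ico 1 (1 + l) = Finset.Icc 1 l := by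
    ext i; simp only [Finset.mem_Ico, Finset.mem_Icc]; omega
  rw [minor_eq_vac g l hl e, contractList_range' (fun i => v m (e i)) l 1 _ η hηη hinv, hIco,
    mul_smul_comm, Finset.mul_sum, map_smul, map_sum, LinearMap.smul_apply, LinearMap.sum_apply,
    map_smul, map_sum, smul_eq_mul, Finset.mul_sum, Finset.mul_sum]
  refine Finset.sum_congr rfl fun I hI => ?_
  rw [Finset.mem_powerset] at hI
  have hcard := card_eq_length_filter l I hI
  have hmem : ∀ (P : ℕ → Bool), ∀ k ∈ ((List.range' 1 l).filter P).map e, k ≤ m := by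
    intro P k hk
    obtain ⟨i, hi, rfl⟩ := List.mem_map.1 hk
    have := (List.mem_range'_1.1 (List.mem_filter.1 hi).1)
    exact he i (by omega) (by omega)
  have hA := hmem (· ∈ I)
  have hB := hmem (· ∉ I)
  rw [show ((List.range' 1 l).filter (· ∈ I)).map (fun i => ι (Q m) (v m (e i)))
      = (((List.range' 1 l).filter (· ∈ I)).map e).map fun i => ι (Q m) (v m i) by
        rw [List.map_map]; rfl,
    show ((List.range' 1 l).filter (· ∉ I)).map (fun i => ι (Q m) (v m (e i)))
      = (((List.range' 1 l).filter (· ∉ I)).map e).map fun i => ι (Q m) (v m i) by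
        rw [List.map_map]; rfl]
  rw [← List.length_map (f := e)] at hcard
  generalize ((List.range' 1 l).filter (· ∈ I)).map e = A at hA hcard ⊢
  generalize ((List.range' 1 l).filter (· ∉ I)).map e = B at hB ⊢
  set bs := (List.range (m - l)).map fun t => v m (m + 2 + t) with hbs
  have h1 := vac_prod_mul_inv_vol g (A.map (v m) ++ bs).reverse
  have h2 : spinRep m (bs.map (ι (Q m))).prod (vol m) = bars m (m - l) (vol m) := by
    rw [map_list_prod, bars, hbs, List.map_map, List.map_map]
    congr 3
    funext t
    exact spinRep_ι m _
  have h3 : spinRep m ((((A.map (v m) ++ bs).reverse.map (ι (Q m))).reverse).prod) (vol m)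
      = ((-1 : ℂ) ^ (m - l) * (-1) ^ (∑ i ∈ Finset.range l, i) * (-1) ^ (I.card * l)) •
        ((List.range' 1 l ++ A).map fun i => ExteriorAlgebra.ι ℂ (vW m i)).prod := by
    rw [List.map_reverse, List.reverse_reverse, List.map_append, List.prod_append, map_mul,
      Module.End.mul_apply, h2, bars_vol_eq m l hl, map_smul, List.map_map]
    rw [show (A.map (ι (Q m) ∘ v m)).prod = (A.map fun i => ι (Q m) (v m i)).prod from rfl,
      spinRep_prod_le A hA, prod_vW_comm, hcard, List.length_range', smul_smul, List.map_append,
      List.prod_append]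
  have h4 : (bs.map (ι (Q m))).reverse.prod * ((A.map fun i => ι (Q m) (v m i)).reverse.prod *
        rowProd g * (B.map fun i => ι (Q m) (v m i)).prod)
      = ((A.map (v m) ++ bs).reverse.map (ι (Q m))).prod * (rowProd g *
        (B.map fun i => ι (Q m) (v m i)).prod) := by
    rw [List.reverse_append, List.map_append, List.prod_append, ← List.map_reverse,
      ← List.map_reverse, ← List.map_reverse, List.map_map]
    rw [← List.map_reverse, List.map_map]
    simp only [mul_assoc]
    rfl
  have h5 : spinRep m (B.map fun i => ι (Q m) (v m i)).prod 1
      = (B.map fun i => ExteriorAlgebra.ι ℂ (vW m i)).prod := by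
    rw [spinRep_prod_le B hB, mul_one]
  rw [mul_smul_comm, h4, map_smul, LinearMap.smul_apply, map_mul, map_mul, Module.End.mul_apply,
    Module.End.mul_apply, h5, spinRep_rowProd, map_smul, map_smul, map_smul, h1, h3, map_smul,
    map_smul]
  simp only [smul_eq_mul, List.length_reverse, List.length_append, List.length_map, hcard, hbs,
    List.length_range, add_comm 1 l]
  have hs : ((Real.sqrt 2 : ℝ) : ℂ)⁻¹ * ((Real.sqrt 2 : ℝ) : ℂ)⁻¹ = 1 / 2 := by
    rw [← mul_inv, ← Complex.ofReal_mul, Real.mul_self_sqrt (by norm_num)]; norm_num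
  generalize vac m (spinRep m g (B.map fun i => ExteriorAlgebra.ι ℂ (vW m i)).prod) = x
  generalize vac m (spinRep m g
    ((List.range' 1 l ++ A).map fun i => ExteriorAlgebra.ι ℂ (vW m i)).prod) = z
  generalize (∑ i ∈ I, (l + 1 - i)) = S
  -- All signs except `(-1)^S` cancel, by a parity check. The two factors `1/√2`, from the column
  -- `v_{m+1}` and from `v_{m+1}` inside `rowProd`, cancel the `2`.
  have hsign : (-1 : ℂ) ^ (m - l) * ((-1) ^ (∑ i ∈ Finset.range (l + 1), i) * η ^ l) * η ^ I.card *
      ((-1) ^ (∑ i ∈ Finset.range (m + 1), i) * (-1) ^ m) *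
      ((-1) ^ (m * (I.card + (m - l)) + ∑ i ∈ Finset.range (m + 1), i)) *
      ((-1 : ℂ) ^ (m - l) * (-1) ^ (∑ i ∈ Finset.range l, i) * (-1) ^ (I.card * l)) = 1 := by
    have hr : ∑ i ∈ Finset.range (l + 1), i = ∑ i ∈ Finset.range l, i + l :=
      Finset.sum_range_succ (fun i => i) l
    obtain ⟨r, rfl⟩ := Nat.exists_eq_add_of_le hl
    rw [hη, ← pow_mul, ← pow_mul, Nat.add_sub_cancel_left, hr]
    simp only [← pow_add]
    generalize ∑ i ∈ Finset.range (l + r + 1), i = T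
    generalize ∑ i ∈ Finset.range l, i = T'
    generalize I.card = c
    refine Even.neg_one_pow ?_
    simp only [Nat.even_add, Nat.even_mul]
    by_cases hl : Even l <;> by_cases hr : Even r <;> by_cases hc : Even c <;>
      by_cases hT : Even T <;> by_cases hT' : Even T' <;> simp [hl, hr, hc, hT, hT']
  have hP : ∀ P : ℂ, P = 1 →
      2 * (((Real.sqrt 2 : ℝ) : ℂ)⁻¹ * ((Real.sqrt 2 : ℝ) : ℂ)⁻¹) * P = 1 := by
    rintro P rfl
    rw [hs]
    norm_num
  linear_combination (-((-1 : ℂ) ^ S) * x * z) * hP _ hsign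

/-! ### From wedge products to strict partitions -/

theorem w_of_pairwise (m : ℕ) (lam : List ℕ) (h : lam.Pairwise (· > ·)) :
    w m lam = ((lam.map fun part => m + 1 - part).map fun i => ExteriorAlgebra.ι ℂ (vW m i)).prod := by
  rw [w, if_pos h, List.map_map]
  rfl

/-- Adding lines at the bottom of `(m, m-1, …, m+1-l)` gives the wedge product, also when the result
is not a strict partition: both are then zero. -/
theorem w_append (m l : ℕ) (hl : l ≤ m) (lam : List ℕ) (h : lam.Pairwise (· > ·))
    (hlam : ∀ k ∈ lam, k ≤ m) :
    w m ((List.range' 1 l).map (fun i => m + 1 - i) ++ lam)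
      = ((List.range' 1 l ++ lam.map fun part => m + 1 - part).map fun i =>
          ExteriorAlgebra.ι ℂ (vW m i)).prod := by
  have hrange : ((List.range' 1 l).map fun i => m + 1 - i).map (fun part => m + 1 - part)
      = List.range' 1 l := by
    rw [List.map_map]
    refine (List.map_congr_left fun i hi => ?_).trans (List.map_id _)
    rw [List.mem_range'_1] at hi
    simp only [Function.comp_apply, id]
    omega
  by_cases hdisj : ∀ k ∈ lam, m + 1 - k ∉ List.range' 1 l
  · rw [w_of_pairwise, List.map_append, hrange]
    refine List.pairwise_append.2 ⟨?_, h, fun x hx k hk => ?_⟩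
    · rw [List.pairwise_map]
      refine List.Pairwise.imp_of_mem (fun {i j} hi hj hij => ?_) (List.pairwise_lt_range' (s := 1))
      rw [List.mem_range'_1] at hi hj
      omega
    · obtain ⟨i, hi, rfl⟩ := List.mem_map.1 hx
      have h1 := hdisj k hk
      have h2 := hlam k hk
      rw [List.mem_range'_1] at h1 hi
      omega
  -- An added line repeats one of `μ_l` or is longer than its last line: the list is not strictly
  -- decreasing, so `w` takes its default value `0`, and the wedge product vanishes by a repeated
  -- factor.
  · push Not at hdisj
    obtain ⟨k, hk, hkl⟩ := hdisj
    have hkm := hlam k hk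
    rw [w, if_neg]
    · obtain ⟨L₁, L₂, rfl⟩ := List.append_of_mem hk
      rw [show (L₁ ++ k :: L₂).map (fun part => m + 1 - part)
          = L₁.map (fun part => m + 1 - part) ++ (m + 1 - k) :: L₂.map fun part => m + 1 - part by simp,
        ← List.append_assoc, List.map_append, List.prod_append,
        List.map_cons, List.prod_cons, ← mul_assoc, prod_mul_eq_zero_of_mem, zero_mul]
      · exact List.mem_map.2 ⟨m + 1 - k, by simp only [List.mem_append, hkl, true_or], rfl⟩
      · intro z hz
        obtain ⟨i, -, rfl⟩ := List.mem_map.1 hz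
        exact ι_anticomm m _ _
      · exact ExteriorAlgebra.ι_sq_zero _
    · intro hp
      have := (List.pairwise_append.1 hp).2.2 (m + 1 - (m + 1 - k)) (List.mem_map.2 ⟨_, hkl, rfl⟩) k hk
      rw [List.mem_range'_1] at hkl
      omega

theorem rho_pairwise (l : ℕ) (r : ℕ → ℕ) (hr : ∀ i j, 1 ≤ i → i < j → j ≤ l → r j < r i)
    (P : ℕ → Bool) : (((List.range' 1 l).filter P).map r).Pairwise (· > ·) := by
  rw [List.pairwise_map]
  have h : (List.range' 1 l).Pairwise fun i j => r j < r i := by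
    refine List.Pairwise.imp_of_mem (fun {i j} hi hj hij => ?_) (List.pairwise_lt_range' (s := 1))
    rw [List.mem_range'_1] at hi hj
    exact hr i j (by omega) hij (by omega)
  exact h.filter _

/-- A line of length `r i` corresponds to column `m + 1 - r i`. The sign comes from the position `i`
in the list and not from `r i`, which is why both families of diagrams share `sgn l`. -/
theorem sum_p_mul_p_eq_minor {m : ℕ} (g : Spin m) (l : ℕ) (hl : l ≤ m) (r : ℕ → ℕ)
    (hr : ∀ i j, 1 ≤ i → i < j → j ≤ l → r j < r i) (hrm : ∀ i, 1 ≤ i → i ≤ l → 1 ≤ r i ∧ r i ≤ m) :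
    ∑ I ∈ (Finset.Icc 1 l).powerset, (-1 : ℂ) ^ sgn l I *
      (p (((List.range' 1 l).filter (· ∉ I)).map r) g *
        p ((List.range' 1 l).map (fun i => m + 1 - i) ++
          ((List.range' 1 l).filter (· ∈ I)).map r) g)
      = minor g (fun s : Fin (m + 1) => m + 1 + s.val)
          (fun t : Fin (m + 1) => columns m l (fun i => m + 1 - r i) t) := by
  rw [← sum_vac_mul_vac_eq_minor g l hl _ fun i hi hi' => by have := hrm i hi hi'; omega]
  refine Finset.sum_congr rfl fun I _ => ?_
  rw [p, p, w_of_pairwise m _ (rho_pairwise l r hr _), w_append m l hl _ (rho_pairwise l r hr _)]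
  · simp only [List.map_map]
    rfl
  · intro k hk
    obtain ⟨i, hi, rfl⟩ := List.mem_map.1 hk
    have := List.mem_range'_1.1 (List.mem_filter.1 hi).1
    exact (hrm i (by omega) (by omega)).2

end LagrangianMirror

open LagrangianMirror in
theorem mainTheorem3 (m j : ℕ) (hj : 2 ≤ j) (hjm : j ≤ m) (a : ℕ → ℕ → ℂ)
    (ha : ∀ i c : ℕ, 1 ≤ c → c ≤ m → m + 1 - c ≤ i → i ≤ m → a i c ≠ 0) :
    (∑ I ∈ (Finset.Icc 1 (m + 1 - j)).powerset,
        (-1 : ℂ) ^ sgn (m + 1 - j) I *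
          (p (rho (m + 1 - j) I) (ubar m a) * p (mu m (m + 1 - j) I) (ubar m a))
      = minor (ubar m a) (fun s : Fin (m + 1) => m + 1 + s.val)
          (fun t : Fin (m + 1) => j + t.val)) ∧
    (∑ I ∈ (Finset.Icc 1 (m + 1 - j)).powerset,
        (-1 : ℂ) ^ sgn (m + 1 - j) I *
          (p (rhoPlus (m + 1 - j) I) (ubar m a) * p (muPlus m (m + 1 - j) I) (ubar m a))
      = minor (ubar m a) (fun s : Fin (m + 1) => m + 1 + s.val)
          (fun t : Fin (m + 1) => if t.val = 0 then j - 1 else j + t.val)) := by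
  constructor
  · refine (sum_p_mul_p_eq_minor (ubar m a) (m + 1 - j) (by omega) (row (m + 1 - j)) ?_ ?_).trans ?_
    · intro i k _ _ _; simp only [row]; omega
    · intro i _ _; simp only [row]; omega
    -- With `l = m + 1 - j`, line `i` of the staircase gives column `j - 1 + i`, so the columns form
    -- an interval starting at `j`.
    · congr 1
      funext t
      simp only [columns, row]
      split_ifs <;> omega
  · refine (sum_p_mul_p_eq_minor (ubar m a) (m + 1 - j) (by omega)
      (rowPlus (m + 1 - j)) ?_ ?_).trans ?_
    · intro i k _ _ _; simp only [rowPlus]; split_ifs <;> omega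
    · intro i _ _; simp only [rowPlus]; split_ifs <;> omega
    -- Lengthening the first line by one moves the first column to `j - 1` and leaves the others in
    -- place.
    · congr 1
      funext t
      simp only [columns, rowPlus]
      split_ifs <;> omega
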